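/- **Theorem.** Let $\mathbf k$ be a field of characteristic zero. Let $\mathcal P=\mathcal P(\mathcal X,\mathcal R)$ be the quadratic nonsymmetric operad over $\mathbf k$ of mock partially associative $8$-ary algebras: $\mathcal X$ is spanned by one operation $\mu$ of arity $8$ and homological degree $0$, and $\mathcal R$ is spanned by $\sum_{i=1}^{8}\mu\circ_i\mu$. Let $\mathcal P^{\vee}=\mathcal C(s\mathcal X,s^2\mathcal R)$ be its Koszul dual cooperad, that is, the largest subcooperad of the cofree conilpotent nonsymmetric cooperad $\mathcal T^c(s\mathcal X)$ whose projection to the weight two part is contained in $s^2\mathcal R$ (here $s$ has homological degree $1$). For a nonsymmetric collection $\mathcal Y$ with finite-dimensional components put $g_{\mathcal Y}(t)=\sum_{m\ge 0}\chi(\mathcal Y(m))\,t^m$, where $\chi$ is the Euler characteristic. Then: 1. $\mathcal P^{\vee}$ is the cooperad $(\widetilde{tAss}{}^{8}_{1})^{c}$ whose coalgebras are mock totally coassociative coalgebras with one operation of arity $8$ and degree $1$, that is, $\mathcal C(\mathcal Y,\mathcal S)$ with $\mathcal Y$ spanned by one element $\nu$ of arity $8$ and degree $1$ and $\mathcal S$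 spanned by $\sum_{i=1}^{8}\nu\circ_i\nu$. Its components are finite-dimensional, and $$g_{\mathcal P^{\vee}}(t)=t-t^8+t^{15}.$$ 2. The power series $t-t^8+t^{15}$ has a unique compositional inverse, and this inverse is of the form $t\,h(t^7)$, where $h$ is a power series with integer coefficients, all of which are (strictly) positive. 3. Hence the positivity criterion ("if the compositional inverse of $g_{\mathcal P^{\vee}}(t)$ has at least one negative coefficient, then $\mathcal P$ is not Koszul") does not detect non-Koszulness of $\mathcal P$: the compositional inverse of $g_{\mathcal P^{\vee}}(t)$ has no negative coefficient. -/

import Mathlib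

open scoped PowerSeries TensorProduct

noncomputable section

namespace NSOperad

/-- Planar rooted trees whose internal vertices are labelled by operations `s : S` and have
`ar s` ordered inputs.  Together with a choice of degrees for the operations, they form a
homogeneous basis of the free nonsymmetric operad, and of the cofree conilpotent nonsymmetric
cooperad, on the graded collection with basis `S`. -/
inductive PlanarTree (S : Type) (ar : S → ℕ) : Type
  | leaf : PlanarTree S ar
  | node (s : S) (ch : Fin (ar s) → PlanarTree S ar) : PlanarTree S ar

namespace PlanarTree

variable {S : Type} {ar : S → ℕ}

/-- The number of leaves, that is, the arity of the tree. -/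
def leaves : PlanarTree S ar → ℕ
  | leaf => 1
  | node _ ch => ∑ j, leaves (ch j)

/-- The number of internal vertices. -/
def weight : PlanarTree S ar → ℕ
  | leaf => 0
  | node _ ch => 1 + ∑ j, weight (ch j)

/-- The homological degree: the sum of the degrees of the labels of the internal vertices. -/
def degree (deg : S → ℤ) : PlanarTree S ar → ℤ
  | leaf => 0
  | node s ch => deg s + ∑ j, degree deg (ch j)

/-- The degree of the label of the root vertex (`0` for the trivial tree). -/
def rootDegree (deg : S → ℤ) : PlanarTree S ar → ℤ
  | leaf => 0
  | node s _ => deg s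

/-- The tree with exactly one internal vertex, labelled `s`. -/
def corolla (s : S) : PlanarTree S ar := node s fun _ => leaf

/-- The tree `s ∘ᵢ t` with two internal vertices: the root is labelled `s`, and its `i`-th input
is the corolla `t`. -/
def corollaComp (s : S) (i : Fin (ar s)) (t : S) : PlanarTree S ar :=
  node s (Function.update (fun _ => leaf) i (corolla t))

lemma degree_add_one (deg : S → ℤ) (T : PlanarTree S ar) :
    T.degree (fun s => deg s + 1) = T.degree deg + T.weight := by
  induction T with
  | leaf => simp [degree, weight]
  | node s ch ih =>
    simp only [degree, weight, ih, Finset.sum_add_distrib]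
    push_cast
    ring

lemma weight_corollaComp (s t : S) (i : Fin (ar s)) : (corollaComp s i t).weight = 2 := by
  have h : ∀ j, (Function.update (fun _ => leaf) i (corolla t) j : PlanarTree S ar).weight
      = if j = i then 1 else 0 := by
    intro j
    by_cases hj : j = i
    · subst hj
      simp [corolla, weight]
    · simp [hj, weight]
  simp [corollaComp, weight, h]

lemma leaves_corollaComp (s t : S) (i : Fin (ar s)) :
    (corollaComp s i t).leaves = (ar s - 1) + ar t := by
  have h : ∀ j, (Function.update (fun _ => leaf) i (corolla t) j : PlanarTree S ar).leaves
      = if j = i then ar t else 1 := by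
    intro j
    by_cases hj : j = i
    · subst hj
      simp [corolla, leaves]
    · simp [hj, leaves]
  simp only [corollaComp, leaves, h]
  rw [← Finset.add_sum_erase _ _ (Finset.mem_univ i)]
  rw [Finset.sum_congr rfl (g := fun _ => 1) (fun j hj => by simp [Finset.ne_of_mem_erase hj])]
  simp [Finset.card_erase_of_mem]
  ring

lemma degree_corollaComp (deg : S → ℤ) (s t : S) (i : Fin (ar s)) :
    (corollaComp s i t).degree deg = deg s + deg t := by
  have h : ∀ j, (Function.update (fun _ => leaf) i (corolla t) j : PlanarTree S ar).degree deg
      = if j = i then deg t else 0 := by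
    intro j
    by_cases hj : j = i
    · subst hj
      simp [corolla, degree]
    · simp [hj, degree]
  simp [corollaComp, degree, h]

end PlanarTree

/-- A way of writing a tree as a graft: the tree is obtained by grafting the root of `lower` into
the leaf of `upper` with (zero-based) number `pos`.  Here `upper` is the part that contains the
root.  The tree monomials are ordered products of vertices in depth-first planar order, and `sign`
is the Koszul sign in `upper ∘_pos lower = sign • tree`. -/
structure Cut (S : Type) (ar : S → ℕ) where
  /-- the part containing the root -/
  upper : PlanarTree S ar
  /-- the number of the leaf at which the other part is grafted -/
  pos : ℕ
  /-- the part that is grafted -/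
  lower : PlanarTree S ar
  /-- the Koszul sign -/
  sign : ℤˣ

/-- All the ways of writing a tree as a graft, each listed once, including the two trivial kinds
where `upper` or `lower` is the trivial tree.  For a cut inside the `j`-th subtree of the root,
the number of the leaf is shifted by the number of leaves to the left of that subtree, and
`lower` has to be moved past the vertices in the subtrees to the right of it. -/
def cuts {S : Type} {ar : S → ℕ} (deg : S → ℤ) : PlanarTree S ar → List (Cut S ar)
  | .leaf => [⟨.leaf, 0, .leaf, 1⟩]
  | .node s ch =>
      ⟨.leaf, 0, .node s ch, 1⟩ ::
        (List.finRange (ar s)).flatMap fun j =>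
          (cuts deg (ch j)).map fun c =>
            { upper := .node s (Function.update ch j c.upper)
              pos := (∑ i ∈ Finset.univ.filter (· < j), (ch i).leaves) + c.pos
              lower := c.lower
              sign := c.sign *
                (c.lower.degree deg *
                  ∑ i ∈ Finset.univ.filter (j < ·), (ch i).degree deg).negOnePow }

/-- The space of tree tensors, the direct sum over all arities and degrees. -/
abbrev TreeSpace (k : Type*) [Field k] (S : Type) (ar : S → ℕ) : Type _ := PlanarTree S ar →₀ k

section

variable {k : Type*} [Field k] {S : Type} {ar : S → ℕ}

/-- The `i`-th infinitesimal decomposition coproduct of the cofree cooperad, dual to the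
operation `∘ᵢ` of grafting at the leaf with number `i`. -/
def decomp (deg : S → ℤ) (i : ℕ) :
    TreeSpace k S ar →ₗ[k] TreeSpace k S ar ⊗[k] TreeSpace k S ar :=
  Finsupp.linearCombination k fun T =>
    (((cuts deg T).filter fun c => c.pos = i).map fun c =>
      c.sign • (Finsupp.single c.upper (1 : k) ⊗ₜ[k] Finsupp.single c.lower (1 : k))).sum

open Classical in
/-- The component of a tree tensor of arity `m` and degree `d`. -/
def homPart (deg : S → ℤ) (m : ℕ) (d : ℤ) (x : TreeSpace k S ar) : TreeSpace k S ar :=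
  x.filter fun T => T.leaves = m ∧ T.degree deg = d

/-- The component of a tree tensor of weight `w`. -/
def weightPart (w : ℕ) (x : TreeSpace k S ar) : TreeSpace k S ar :=
  x.filter fun T => T.weight = w

/-- A subspace of the space of tree tensors is a (graded) subcollection if it is the direct sum of
its components of given arity and degree. -/
def IsSubcollection (deg : S → ℤ) (Q : Submodule k (TreeSpace k S ar)) : Prop :=
  ∀ x ∈ Q, ∀ m d, homPart deg m d x ∈ Q

/-- A subcollection `Q` of the cofree cooperad is a subcooperad if the decomposition coproducts
send `Q` to `Q ⊗ Q`. -/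
structure IsSubcooperad (deg : S → ℤ) (Q : Submodule k (TreeSpace k S ar)) : Prop where
  isSubcollection : IsSubcollection deg Q
  decomp_mem : ∀ i, ∀ x ∈ Q,
    decomp deg i x ∈ LinearMap.range (TensorProduct.map Q.subtype Q.subtype)

/-- The component of a subcollection in arity `m`. -/
def component (Q : Submodule k (TreeSpace k S ar)) (m : ℕ) : Submodule k (TreeSpace k S ar) :=
  Q ⊓ Finsupp.supported k k {T | T.leaves = m}

/-- The component of a subcollection in arity `m` and degree `d`. -/
def homComponent (deg : S → ℤ) (Q : Submodule k (TreeSpace k S ar)) (m : ℕ) (d : ℤ) :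
    Submodule k (TreeSpace k S ar) :=
  Q ⊓ Finsupp.supported k k {T | T.leaves = m ∧ T.degree deg = d}

/-- The Euler characteristic of the component in arity `m` (meant for finite-dimensional
components). -/
def eulerChar (deg : S → ℤ) (Q : Submodule k (TreeSpace k S ar)) (m : ℕ) : ℤ :=
  ∑ᶠ d : ℤ, (d.negOnePow : ℤ) * (Module.finrank k (homComponent deg Q m d) : ℤ)

/-- The Poincaré series of a subcollection with finite-dimensional components: the generating
series for the Euler characteristics of its components. -/
def poincareSeries (deg : S → ℤ) (Q : Submodule k (TreeSpace k S ar)) : ℤ⟦X⟧ :=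
  PowerSeries.mk (eulerChar deg Q)

/-- The map `s²`, used for tree tensors of weight two: `μ ∘ᵢ ν` goes to the tree
`(-1)^|μ| sμ ∘ᵢ sν`, where the second suspension symbol moves past the label `μ` of the root. (The
suspended operations are labelled by the same set, only their degrees change.) -/
def doubleSuspension (deg : S → ℤ) : TreeSpace k S ar →ₗ[k] TreeSpace k S ar :=
  Finsupp.linearCombination k fun T => (T.rootDegree deg).negOnePow • Finsupp.single T (1 : k)

lemma doubleSuspension_apply (deg : S → ℤ) (x : TreeSpace k S ar) (T : PlanarTree S ar) :
    doubleSuspension deg x T = (T.rootDegree deg).negOnePow • x T := by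
  classical
  induction x using Finsupp.induction_linear with
  | zero => simp
  | add x y hx hy => simp only [map_add, Finsupp.add_apply, hx, hy, smul_add]
  | single U a =>
    rw [doubleSuspension, Finsupp.linearCombination_single, Finsupp.smul_apply, Finsupp.smul_apply]
    by_cases h : U = T
    · subst h
      simp [Units.smul_def, mul_comm]
    · simp [h]

lemma homPart_apply (deg : S → ℤ) (m : ℕ) (d : ℤ) (x : TreeSpace k S ar) (T : PlanarTree S ar) :
    homPart deg m d x T = open Classical in
      if T.leaves = m ∧ T.degree deg = d then x T else 0 := by
  classical
  simp only [homPart, Finsupp.filter_apply]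

/-- `homPart` as a linear map. -/
def homPartₗ (deg : S → ℤ) (m : ℕ) (d : ℤ) : TreeSpace k S ar →ₗ[k] TreeSpace k S ar where
  toFun := homPart deg m d
  map_add' _ _ := by classical exact Finsupp.filter_add
  map_smul' _ _ := by classical exact Finsupp.filter_smul

/-- `weightPart` as a linear map. -/
def weightPartₗ (w : ℕ) : TreeSpace k S ar →ₗ[k] TreeSpace k S ar where
  toFun := weightPart w
  map_add' _ _ := Finsupp.filter_add
  map_smul' _ _ := Finsupp.filter_smul

end

/-- Quadratic data `(X, R)` over `k`: a graded collection `X`, given through a homogeneous basis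
`S`, and a subcollection `R` of the weight two part of the free operad on `X`. -/
structure QuadraticData (k : Type*) [Field k] where
  /-- a homogeneous basis of the collection of generators -/
  S : Type
  /-- arities of the generators -/
  ar : S → ℕ
  /-- homological degrees of the generators -/
  deg : S → ℤ
  two_le_ar : ∀ s, 2 ≤ ar s
  /-- the relations -/
  rel : Submodule k (TreeSpace k S ar)
  rel_le : rel ≤ Finsupp.supported k k {T | T.weight = 2}
  rel_isSubcollection : IsSubcollection deg rel

namespace QuadraticData

variable {k : Type*} [Field k]

/-- The quadratic cooperad `C(X, R)`: the largest subcooperad of the cofree cooperad on `X` whose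
projection to the weight two part is contained in `R`. -/
def cooperad (D : QuadraticData k) : Submodule k (TreeSpace k D.S D.ar) :=
  sSup {Q | IsSubcooperad D.deg Q ∧ ∀ x ∈ Q, weightPart 2 x ∈ D.rel}

/-- The defining supremum is attained: it is itself such a subcooperad. -/
lemma isGreatest_cooperad (D : QuadraticData k) :
    IsGreatest {Q | IsSubcooperad D.deg Q ∧ ∀ x ∈ Q, weightPart 2 x ∈ D.rel} D.cooperad := by
  refine ⟨⟨⟨?_, ?_⟩, ?_⟩, fun Q hQ => le_sSup hQ⟩
  · intro x hx m d
    have key : D.cooperad ≤ D.cooperad.comap (homPartₗ D.deg m d) :=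
      sSup_le fun Q hQ y hy => (le_sSup hQ : Q ≤ D.cooperad) (hQ.1.isSubcollection y hy m d)
    exact key hx
  · intro i x hx
    have key : D.cooperad ≤ (LinearMap.range (TensorProduct.map D.cooperad.subtype
        D.cooperad.subtype)).comap (decomp D.deg i) := by
      refine sSup_le fun Q hQ y hy => ?_
      obtain ⟨z, hz⟩ := hQ.1.decomp_mem i y hy
      have hle : Q ≤ D.cooperad := le_sSup hQ
      refine ⟨TensorProduct.map (Submodule.inclusion hle) (Submodule.inclusion hle) z, ?_⟩
      rw [← hz, ← LinearMap.comp_apply, ← TensorProduct.map_comp]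
      rfl
    exact key hx
  · intro x hx
    have key : D.cooperad ≤ D.rel.comap (weightPartₗ 2) := sSup_le fun Q hQ y hy => hQ.2 y hy
    exact key hx

/-- The suspended quadratic data `(sX, s²R)`. -/
def suspend (D : QuadraticData k) : QuadraticData k where
  S := D.S
  ar := D.ar
  deg s := D.deg s + 1
  two_le_ar := D.two_le_ar
  rel := D.rel.map (doubleSuspension D.deg)
  rel_le := by
    rintro _ ⟨x, hx, rfl⟩
    rw [Finsupp.mem_supported']
    intro T hT
    rw [doubleSuspension_apply, (Finsupp.mem_supported' k x).1 (D.rel_le hx) T hT, smul_zero]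
  rel_isSubcollection := by
    rintro _ ⟨x, hx, rfl⟩ m d
    refine ⟨homPart D.deg m (d - 2) x, D.rel_isSubcollection x hx m (d - 2), ?_⟩
    ext T
    rw [doubleSuspension_apply, homPart_apply, homPart_apply, doubleSuspension_apply]
    by_cases hT : T.weight = 2
    · have h : (T.degree D.deg = d - 2) ↔ T.degree (fun s => D.deg s + 1) = d := by
        rw [PlanarTree.degree_add_one, hT]
        push_cast
        omega
      simp only [h, smul_ite, smul_zero]
    · have h0 : x T = 0 := (Finsupp.mem_supported' k x).1 (D.rel_le hx) T hT
      simp [h0]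

/-- The Koszul dual cooperad `C(sX, s²R)` of the quadratic operad with generators `X` and
relations `R`. -/
def koszulDual (D : QuadraticData k) : Submodule k (TreeSpace k D.S D.ar) :=
  D.suspend.cooperad

/-- The quadratic data with one generator `μ` of arity `n` and degree `d`, and with the space of
relations spanned by the sum of all `μ ∘ᵢ μ`, where `1 ≤ i ≤ n`. -/
def mock (k : Type*) [Field k] (n : ℕ) (hn : 2 ≤ n) (d : ℤ) : QuadraticData k where
  S := Unit
  ar _ := n
  deg _ := d
  two_le_ar _ := hn
  rel := Submodule.span k
    {∑ i : Fin n, Finsupp.single (PlanarTree.corollaComp (ar := fun _ => n) () i ()) (1 : k)}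
  rel_le := by
    rw [Submodule.span_singleton_le_iff_mem]
    exact Submodule.sum_mem _ fun i _ =>
      Finsupp.single_mem_supported k _ (PlanarTree.weight_corollaComp _ _ _)
  rel_isSubcollection := by
    intro x hx m e
    obtain ⟨c, rfl⟩ := Submodule.mem_span_singleton.1 hx
    change homPartₗ _ m e _ ∈ _
    have h : ∀ i : Fin n, homPartₗ (k := k) (fun _ => d) m e
        (Finsupp.single (PlanarTree.corollaComp (ar := fun _ => n) () i ()) (1 : k)) =
        (if (n - 1) + n = m ∧ d + d = e then (1 : k) else 0) •
          Finsupp.single (PlanarTree.corollaComp (ar := fun _ => n) () i ()) (1 : k) := by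
      intro i
      ext T
      change homPart _ m e _ T = _
      rw [homPart_apply, Finsupp.smul_apply]
      by_cases hT : PlanarTree.corollaComp (ar := fun _ => n) () i () = T
      · subst hT
        rw [PlanarTree.leaves_corollaComp, PlanarTree.degree_corollaComp]
        simp
      · simp [hT]
    rw [map_smul, map_sum, Finset.sum_congr rfl fun i _ => h i, ← Finset.smul_sum]
    exact Submodule.smul_mem _ _ (Submodule.smul_mem _ _ (Submodule.mem_span_singleton_self _))

end QuadraticData

/-- The quadratic data of the operad of mock partially associative `n`-ary algebras: one generator
`μ` of arity `n` and degree `0`, and one relation `∑ᵢ μ ∘ᵢ μ = 0`. -/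
abbrev mockPartiallyAssociative (k : Type*) [Field k] (n : ℕ) (hn : 2 ≤ n) : QuadraticData k :=
  QuadraticData.mock k n hn 0

/-- The cooperad whose coalgebras are mock totally coassociative coalgebras with one operation of
arity `n` and degree `1`: the weight two part of a decomposition has to be a multiple of
`∑ᵢ μ ∘ᵢ μ`, which says that the composites of the cooperation with itself at all the places `i`
are equal. -/
abbrev mockTotallyCoassociative (k : Type*) [Field k] (n : ℕ) (hn : 2 ≤ n) :
    Submodule k (TreeSpace k Unit fun _ => n) :=
  (QuadraticData.mock k n hn 1).cooperad

/-- `f` is the compositional inverse of `g`. -/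
structure IsCompInverse {R : Type*} [CommRing R] (g f : R⟦X⟧) : Prop where
  constantCoeff_left : PowerSeries.constantCoeff g = 0
  constantCoeff_right : PowerSeries.constantCoeff f = 0
  comp_left : PowerSeries.subst f g = PowerSeries.X
  comp_right : PowerSeries.subst g f = PowerSeries.X

/-- The positivity criterion detects that the quadratic operad with data `D` (whose generators have
degree zero) is not Koszul: the compositional inverse of the Poincaré series of the Koszul dual
cooperad has at least one negative coefficient. -/
def DetectedByPositivityCriterion {k : Type*} [Field k] (D : QuadraticData k) : Prop :=
  ∃ f : ℤ⟦X⟧, IsCompInverse (poincareSeries D.suspend.deg D.koszulDual) f ∧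
    ∃ n, PowerSeries.coeff n f < 0

end NSOperad

end

/-! Cooperad side. A subcooperad `Q` is used through coordinates: for `x ∈ Q`, a fixed leaf `p` and
a fixed tree `V`, there is an element of `Q` whose coefficient at `U` is, up to the Koszul sign,
that of `x` at the graft of `V` onto the leaf `p` of `U`; the same holds with `U` fixed
(`IsSubcooperad.exists_right`, `IsSubcooperad.exists_left`). The relation makes all weight two
coefficients of an element of `Q` equal. Hence weight three coefficients agree, up to sign, whenever
the trees arise by grafting a corolla at the same leaf number. A tree with two vertices side by side
above the root arises in two such ways, with opposite signs since the operation has odd degree.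
Comparing the extreme positions gives `2 * c = 0`, so weight three vanishes, and removing corollas
kills all higher weights. What remains is spanned by the sums of all trees of weight 0, 1 and 2, of
arities 1, 8, 15 and degrees 0, 1, 2; this span is indeed a subcooperad
(`mockTotallyCoassociative_eq`). The Koszul dual has the same description because the double
suspension involves no sign when the generator has degree zero.

Series side. With `ψ = 1 / (1 - X + X ^ 2)`, Lagrange inversion identifies `7 * k + 1` times the
coefficient of `X ^ (7 * k + 1)` in the inverse with the coefficient of `X ^ k` in `ψ ^ (7 * k +
1)`; the other coefficients vanish. The coefficients of `ψ ^ N` satisfy a three-term recurrence, and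
a lower bound on their successive ratios propagates up to index `k` when `N = 7 * k + 1`
(`coeff_pow_pos`). -/

noncomputable section

namespace PowerSeries

/-! ### Lagrange inversion over the integers, without Laurent series. -/

section Lagrange

variable {φ ψ : ℤ⟦X⟧}

lemma derivative_eq_of_mul_eq_one (h : ψ * φ = 1) : d⁄dX ℤ ψ = -(ψ ^ 2 * d⁄dX ℤ φ) := by
  have h1 : d⁄dX ℤ (ψ * φ) = 0 := by rw [h]; exact derivative_one
  rw [Derivation.leibniz, smul_eq_mul, smul_eq_mul] at h1
  linear_combination ψ * h1 - d⁄dX ℤ ψ * h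

lemma derivative_X_mul (φ : ℤ⟦X⟧) : d⁄dX ℤ (X * φ) = φ + X * d⁄dX ℤ φ := by
  rw [Derivation.leibniz, smul_eq_mul, smul_eq_mul, derivative_X]
  ring

/-- The residue of `g ^ (m - 1 - n) * g'`, where `g = X * φ`, in the case `m ≤ n`. -/
lemma coeff_pow_mul_derivative_X_mul (h : ψ * φ = 1) (r : ℕ) :
    coeff r (ψ ^ (r + 1) * d⁄dX ℤ (X * φ)) = if r = 0 then 1 else 0 := by
  have h0 : ψ ^ (r + 1) * d⁄dX ℤ (X * φ) = ψ ^ r + X * (ψ ^ (r + 1) * d⁄dX ℤ φ) := by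
    rw [derivative_X_mul]
    linear_combination ψ ^ r * h
  rw [h0]
  rcases r with _ | r
  · simp
  -- The residue of a derivative vanishes: `ψ ^ (r + 1)` has derivative `-(r + 1) ψ ^ (r + 2) φ'`,
  -- so the two terms of `h0` cancel after multiplication by `r + 1`, which is nonzero in `ℤ`.
  · have h1 : d⁄dX ℤ (ψ ^ (r + 1)) = -((r + 1 : ℕ) • (ψ ^ (r + 1 + 1) * d⁄dX ℤ φ)) := by
      rw [Derivation.leibniz_pow, derivative_eq_of_mul_eq_one h]
      simp only [nsmul_eq_mul, smul_eq_mul, Nat.add_sub_cancel]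
      ring
    have h2 := congrArg (coeff r) h1
    rw [coeff_derivative, map_neg, map_nsmul, nsmul_eq_mul] at h2
    rw [map_add, coeff_succ_X_mul, if_neg (Nat.succ_ne_zero r)]
    have h3 : ((r : ℤ) + 1) ≠ 0 := by positivity
    apply mul_left_cancel₀ h3
    push_cast at h2
    linear_combination h2

/-- With `g = X * φ`, terms of `D` beyond degree `n` only contribute multiples of `X ^ (n + 1)`. For
`m ≤ n` one has `g ^ m * ψ ^ (n + 1) = X ^ m * ψ ^ (n - m + 1)`, so the `m`-th term contributes a
residue that is zero unless `m = n`. -/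
lemma coeff_subst_mul_derivative (h : ψ * φ = 1) (D : ℤ⟦X⟧) (n : ℕ) :
    coeff n (subst (X * φ) D * d⁄dX ℤ (X * φ) * ψ ^ (n + 1)) = coeff n D := by
  have hs : HasSubst (X * φ : ℤ⟦X⟧) := HasSubst.of_constantCoeff_zero' (by simp)
  have hpow : ∀ m, m ≤ n → (X * φ) ^ m * d⁄dX ℤ (X * φ) * ψ ^ (n + 1)
      = X ^ m * (ψ ^ (n - m + 1) * d⁄dX ℤ (X * φ)) := by
    intro m hm
    obtain ⟨r, rfl⟩ := Nat.exists_eq_add_of_le hm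
    have h1 : ψ ^ (m + r + 1) * φ ^ m = ψ ^ (r + 1) := by
      rw [show m + r + 1 = m + (r + 1) by ring, pow_add, mul_right_comm, ← mul_pow, h, one_pow,
        one_mul]
    rw [Nat.add_sub_cancel_left, mul_pow, ← h1]
    ring
  obtain ⟨q, hq⟩ : ∃ q, D = X ^ (n + 1) * q + (trunc (n + 1) D : ℤ⟦X⟧) :=
    ⟨_, eq_X_pow_mul_shift_add_trunc (n + 1) D⟩
  have hsum : (trunc (n + 1) D : ℤ⟦X⟧)
      = ∑ m ∈ Finset.range (n + 1), C (coeff m D) * X ^ m := by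
    ext j
    simp [coeff_trunc, coeff_C_mul, coeff_X_pow, -eq_intCast]
  have key : subst (X * φ) D = (X * φ) ^ (n + 1) * subst (X * φ) q
      + ∑ m ∈ Finset.range (n + 1), C (coeff m D) * (X * φ) ^ m := by
    have hC : ∀ a : ℤ, substAlgHom hs (C a) = C a := fun a => by
      rw [coe_substAlgHom]
      exact subst_C a
    conv_lhs => rw [hq, hsum]
    rw [← coe_substAlgHom hs]
    simp only [map_add, map_mul (substAlgHom hs), map_pow (substAlgHom hs), map_sum, hC,
      substAlgHom_X]
  rw [key, add_mul, add_mul, map_add, mul_pow]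
  rw [show X ^ (n + 1) * φ ^ (n + 1) * subst (X * φ) q * d⁄dX ℤ (X * φ) * ψ ^ (n + 1)
    = X ^ (n + 1) * (φ ^ (n + 1) * subst (X * φ) q * d⁄dX ℤ (X * φ) * ψ ^ (n + 1)) by ring,
    coeff_X_pow_mul', if_neg (by omega), zero_add, Finset.sum_mul, Finset.sum_mul, map_sum,
    Finset.sum_eq_single n]
  · rw [mul_assoc, mul_assoc, coeff_C_mul, ← mul_assoc ((X * φ) ^ _), hpow n le_rfl,
      coeff_X_pow_mul', if_pos le_rfl, Nat.sub_self, coeff_pow_mul_derivative_X_mul h]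
    simp
  · intro m hm hmn
    have hm' : m < n + 1 := Finset.mem_range.1 hm
    rw [mul_assoc, mul_assoc, coeff_C_mul, ← mul_assoc ((X * φ) ^ _), hpow m (by omega),
      coeff_X_pow_mul', if_pos (by omega), coeff_pow_mul_derivative_X_mul h, if_neg (by omega), mul_zero]
  · simp

/-- Lagrange inversion for integral power series. -/
lemma coeff_eq_of_subst_eq_X (h : ψ * φ = 1) {f : ℤ⟦X⟧} (hf : subst (X * φ) f = X) (n : ℕ) :
    (n + 1) * coeff (n + 1) f = coeff n (ψ ^ (n + 1)) := by
  have hs : HasSubst (X * φ : ℤ⟦X⟧) := HasSubst.of_constantCoeff_zero' (by simp)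
  -- The choice `D = f'` works because `f'(g) * g'` is the derivative of `f ∘ g = X`.
  have h1 := coeff_subst_mul_derivative h (d⁄dX ℤ f) n
  rw [← derivative_subst hs, hf, derivative_X, one_mul, coeff_derivative] at h1
  rw [h1, mul_comm]

end Lagrange

/-! ### Positivity of the coefficients given by Lagrange inversion. -/

section Positivity

/-- A differential equation for the powers of the inverse of `1 - X + X ^ 2`. -/
lemma mul_derivative_pow {ψ : ℤ⟦X⟧} (h : ψ * (1 - X + X ^ 2) = 1) (N : ℕ) :
    (1 - X + X ^ 2) * d⁄dX ℤ (ψ ^ N) = C (N : ℤ) * ψ ^ N - C (2 * N : ℤ) * (X * ψ ^ N) := by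
  have hd : d⁄dX ℤ (1 - X + X ^ 2 : ℤ⟦X⟧) = -1 + 2 * X := by
    rw [map_add, map_sub, derivative_one, derivative_X, Derivation.leibniz_pow, derivative_X]
    simp
  rcases N with _ | N
  · simp
  · rw [Derivation.leibniz_pow, derivative_eq_of_mul_eq_one h, hd]
    simp only [Nat.add_sub_cancel, smul_eq_mul, nsmul_eq_mul, map_mul, eq_intCast]
    push_cast
    linear_combination ((N : ℤ⟦X⟧) + 1) * ψ ^ (N + 1) * (1 - 2 * X) * h

lemma coeff_zero_and_coeff_one_pow {ψ : ℤ⟦X⟧} (h : ψ * (1 - X + X ^ 2) = 1) (N : ℕ) :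
    coeff 0 (ψ ^ N) = 1 ∧ coeff 1 (ψ ^ N) = N := by
  have h0 : constantCoeff ψ = 1 := by simpa using congrArg constantCoeff h
  have h1 : coeff 0 (ψ ^ N) = 1 := by simp [h0]
  refine ⟨h1, ?_⟩
  have h2 := congrArg (coeff 0) (mul_derivative_pow h N)
  rw [map_sub, coeff_C_mul, coeff_C_mul, h1, coeff_zero_X_mul, coeff_zero_eq_constantCoeff_apply,
    map_mul, ← coeff_zero_eq_constantCoeff_apply (d⁄dX ℤ _), coeff_derivative] at h2
  simpa using h2

/-- The recurrence for the coefficients of a power of the inverse of `1 - X + X ^ 2`. -/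
lemma coeff_pow_recurrence {ψ : ℤ⟦X⟧} (h : ψ * (1 - X + X ^ 2) = 1) (N j : ℕ) :
    ((j : ℤ) + 2) * coeff (j + 2) (ψ ^ N)
      = (j + 1 + N) * coeff (j + 1) (ψ ^ N) - (2 * N + j) * coeff j (ψ ^ N) := by
  have h2 := congrArg (coeff (j + 1)) (mul_derivative_pow h N)
  rw [show (1 - X + X ^ 2) * d⁄dX ℤ (ψ ^ N)
      = d⁄dX ℤ (ψ ^ N) - X * d⁄dX ℤ (ψ ^ N) + X * (X * d⁄dX ℤ (ψ ^ N)) by ring] at h2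
  simp only [map_add, map_sub, coeff_C_mul, coeff_succ_X_mul, coeff_derivative] at h2
  rcases j with _ | j
  · simp only [zero_add, coeff_zero_X_mul] at h2 ⊢
    push_cast at h2 ⊢
    linear_combination h2
  · rw [coeff_succ_X_mul, coeff_derivative] at h2
    push_cast at h2 ⊢
    linear_combination h2

/-- Write `N = 7 * k + 1` and `a j` for the coefficients of `ψ ^ N`. The second conjunct says that
the positive term of the recurrence is at most twice the next coefficient `(j + 1) * a (j + 1)`,
that is, the subtracted term eats at most half of it. This strengthening is what makes the induction
close, and it yields positivity of the next coefficient. -/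
lemma coeff_pow_pos {ψ : ℤ⟦X⟧} (h : ψ * (1 - X + X ^ 2) = 1) (k j : ℕ) (hj : j < k) :
    0 < coeff j (ψ ^ (7 * k + 1)) ∧
      ((j : ℤ) + 1 + (7 * k + 1)) * coeff j (ψ ^ (7 * k + 1))
        ≤ 2 * (j + 1) * coeff (j + 1) (ψ ^ (7 * k + 1)) := by
  induction j with
  | zero =>
    obtain ⟨h0, h1⟩ := coeff_zero_and_coeff_one_pow h (7 * k + 1)
    rw [zero_add, h0, h1]
    push_cast
    exact ⟨trivial, by linarith⟩
  | succ j ih =>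
    obtain ⟨h0, h1⟩ := ih (by omega)
    have hrec := coeff_pow_recurrence h (7 * k + 1) j
    rw [add_assoc j 1 1]
    push_cast at hrec ⊢
    generalize coeff j (ψ ^ (7 * k + 1)) = a at *
    generalize coeff (j + 1) (ψ ^ (7 * k + 1)) = b at *
    generalize coeff (j + 2) (ψ ^ (7 * k + 1)) = c at *
    have hk : (j : ℤ) + 2 ≤ k := by exact_mod_cast hj
    generalize (k : ℤ) = K at *
    have hJ : (0 : ℤ) ≤ j := by positivity
    generalize (j : ℤ) = J at *
    have hb : 0 < b := by
      have : 0 < 2 * (J + 1) * b := lt_of_lt_of_le (mul_pos (by linarith) h0) h1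
      exact pos_of_mul_pos_right this (by linarith)
    refine ⟨hb, ?_⟩
    have hpos : 0 < J + 1 + (7 * K + 1) := by linarith
    -- By the recurrence, this is a rearrangement of the ratio bound for the next index.
    have key : 2 * (2 * (7 * K + 1) + J) * a ≤ (J + (7 * K + 1)) * b := by
      refine le_of_mul_le_mul_left ?_ hpos
      have e1 : (J + 1 + (7 * K + 1)) * (2 * (2 * (7 * K + 1) + J) * a)
          ≤ 2 * (2 * (7 * K + 1) + J) * (2 * (J + 1) * b) := by
        nlinarith [mul_le_mul_of_nonneg_left h1
          (by linarith : (0 : ℤ) ≤ 2 * (2 * (7 * K + 1) + J))]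
      -- The place where 7 is large enough: along `J = K` the leading coefficients of the two sides
      -- are `4 * 15 = 60` and `8 ^ 2 = 64`.
      have e2 : 4 * (2 * (7 * K + 1) + J) * (J + 1)
          ≤ (J + 1 + (7 * K + 1)) * (J + (7 * K + 1)) := by
        obtain ⟨d, rfl⟩ : ∃ d, K = J + 2 + d := ⟨K - J - 2, by ring⟩
        have hd : 0 ≤ d := by linarith
        nlinarith [mul_nonneg hJ hd, mul_nonneg hJ hJ, mul_nonneg hd hd]
      nlinarith [mul_le_mul_of_nonneg_right e2 hb.le]
    linarith

lemma coeff_self_pow_pos {ψ : ℤ⟦X⟧} (h : ψ * (1 - X + X ^ 2) = 1) (k : ℕ) :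
    0 < coeff k (ψ ^ (7 * k + 1)) := by
  rcases k with _ | k
  · rw [(coeff_zero_and_coeff_one_pow h _).1]
    exact one_pos
  -- The ratio bound at the last admissible index also reaches the endpoint.
  · obtain ⟨h0, h1⟩ := coeff_pow_pos h (k + 1) k (Nat.lt_succ_self k)
    have : 0 < 2 * ((k : ℤ) + 1) * coeff (k + 1) (ψ ^ (7 * (k + 1) + 1)) :=
      lt_of_lt_of_le (mul_pos (by positivity) h0) h1
    exact pos_of_mul_pos_right this (by positivity)

end Positivity

/-- A left compositional inverse of `X - X ^ 8 + X ^ 15` is `X * h (X ^ 7)` with `h` positive. -/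
lemma exists_pos_of_subst_eq_X {f : ℤ⟦X⟧} (hf0 : constantCoeff f = 0)
    (hf : subst (X - X ^ 8 + X ^ 15 : ℤ⟦X⟧) f = X) :
    ∃ h : ℤ⟦X⟧, (∀ n, 0 < coeff n h) ∧ f = X * subst (X ^ 7 : ℤ⟦X⟧) h := by
  have hs : HasSubst (X ^ 7 : ℤ⟦X⟧) := HasSubst.X_pow (by norm_num)
  obtain ⟨ψ, hψ⟩ : ∃ ψ : ℤ⟦X⟧, ψ * (1 - X + X ^ 2) = 1 := by
    refine ⟨invOfUnit (1 - X + X ^ 2) 1, ?_⟩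
    rw [mul_comm]
    exact mul_invOfUnit _ _ (by simp)
  have hψ7 : subst (X ^ 7 : ℤ⟦X⟧) ψ * (1 - X ^ 7 + X ^ 14) = 1 := by
    have := congrArg (substAlgHom hs) hψ
    rw [map_mul, map_add, map_sub, map_one, map_pow, substAlgHom_X, coe_substAlgHom] at this
    linear_combination this
  have hf' : subst (X * (1 - X ^ 7 + X ^ 14) : ℤ⟦X⟧) f = X := by
    rw [show (X * (1 - X ^ 7 + X ^ 14) : ℤ⟦X⟧) = X - X ^ 8 + X ^ 15 by ring, hf]
  have hc := coeff_eq_of_subst_eq_X hψ7 hf'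
  -- Substituting `X ^ 7` leaves only the exponents `n = 7 * k`, where the coefficient is that of `X
  -- ^ k` in `ψ ^ (7 * k + 1)`.
  have hc' : ∀ n : ℕ, ((n : ℤ) + 1) * coeff (n + 1) f
      = if 7 ∣ n then coeff (n / 7) (ψ ^ (n + 1)) else 0 := by
    intro n
    rw [hc, ← subst_pow hs, coeff_subst_X_pow (by norm_num)]
    rfl
  refine ⟨mk fun k => coeff (7 * k + 1) f, fun k => ?_, ?_⟩
  · have h1 := hc' (7 * k)
    rw [if_pos (dvd_mul_right 7 k), Nat.mul_div_cancel_left k (by norm_num)] at h1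
    rw [coeff_mk]
    have h2 := coeff_self_pow_pos hψ k
    rw [← h1] at h2
    exact pos_of_mul_pos_right h2 (by positivity)
  · ext n
    rcases n with _ | n
    · simp [hf0]
    · rw [coeff_succ_X_mul, coeff_subst_X_pow (by norm_num), coeff_mk]
      split_ifs with hn
      · rw [Nat.mul_div_cancel' hn]
        rfl
      · have h1 := hc' n
        rw [if_neg hn] at h1
        exact (mul_eq_zero.1 h1).resolve_left (by positivity)

end PowerSeries

/-! ### Existence, uniqueness and sign pattern of the compositional inverse. -/

namespace NSOperad

open PowerSeries

/-- Associativity of composition: `f = f ∘ (g ∘ f') = (f ∘ g) ∘ f' = f'`. -/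
lemma IsCompInverse.eq {R : Type*} [CommRing R] {g f f' : R⟦X⟧} (h : IsCompInverse g f)
    (h' : IsCompInverse g f') : f = f' := by
  have hg : HasSubst g := HasSubst.of_constantCoeff_zero' h.constantCoeff_left
  have hf' : HasSubst f' := HasSubst.of_constantCoeff_zero' h'.constantCoeff_right
  have h1 := subst_comp_subst_apply hg hf' f
  rw [h.comp_right, h'.comp_left, subst_X hf', X_subst] at h1
  exact h1.symm

lemma exists_isCompInverse :
    ∃ h : ℤ⟦X⟧, (∀ n, 0 < PowerSeries.coeff n h) ∧ ∀ f : ℤ⟦X⟧,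
      IsCompInverse (PowerSeries.X - PowerSeries.X ^ 8 + PowerSeries.X ^ 15 : ℤ⟦X⟧) f ↔
        f = PowerSeries.X * PowerSeries.subst (PowerSeries.X ^ 7 : ℤ⟦X⟧) h := by
  have h0 : constantCoeff (X - X ^ 8 + X ^ 15 : ℤ⟦X⟧) = 0 := by simp
  have h1 : IsUnit (coeff 1 (X - X ^ 8 + X ^ 15 : ℤ⟦X⟧)) := by simp [coeff_X_pow]
  have hinv : IsCompInverse (X - X ^ 8 + X ^ 15 : ℤ⟦X⟧) (substInvOfIsUnit _ h1) :=
    ⟨h0, constantCoeff_substInvOfIsUnit _ h1, subst_substInvOfIsUnit_right _ h0 h1,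
      subst_substInvOfIsUnit_left _ h0 h1⟩
  obtain ⟨h, hpos, hh⟩ := exists_pos_of_subst_eq_X hinv.constantCoeff_right hinv.comp_right
  refine ⟨h, hpos, fun f => ⟨fun hf => ?_, ?_⟩⟩
  · rw [hf.eq hinv, ← hh]
  · rintro rfl
    rwa [← hh]

lemma coeff_X_mul_subst_nonneg {h : ℤ⟦X⟧} (hpos : ∀ n, 0 < PowerSeries.coeff n h) (n : ℕ) :
    0 ≤ PowerSeries.coeff n (PowerSeries.X * PowerSeries.subst (PowerSeries.X ^ 7 : ℤ⟦X⟧) h) := by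
  rcases n with _ | n
  · simp
  · rw [coeff_succ_X_mul, coeff_subst_X_pow (by norm_num)]
    split_ifs
    · exact (hpos _).le
    · exact le_rfl

/-! ### Numbering the leaves of a tree by consecutive blocks, one for each child of the root. -/

section Blocks

variable {n : ℕ} (a : Fin n → ℕ)

lemma sum_filter_lt_eq (j : Fin n) :
    ∑ i ∈ Finset.univ.filter (· < j), a i = ∑ i : Fin j, a (Fin.castLE j.2.le i) := by
  refine Eq.trans ?_ (Finset.sum_map Finset.univ (Fin.castLEEmb j.2.le) a)
  congr 1
  ext i
  simp only [Finset.mem_filter, Finset.mem_univ, true_and, Finset.mem_map, Fin.castLEEmb_apply]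
  constructor
  · intro h
    exact ⟨⟨i, h⟩, rfl⟩
  · rintro ⟨l, rfl⟩
    exact l.2

lemma block_unique {j j' : Fin n} {p p' : ℕ} (hp : p < a j) (hp' : p' < a j')
    (h : (∑ i ∈ Finset.univ.filter (· < j), a i) + p
      = (∑ i ∈ Finset.univ.filter (· < j'), a i) + p') : j = j' := by
  rw [sum_filter_lt_eq, sum_filter_lt_eq] at h
  have h1 : (finSigmaFinEquiv ⟨j, ⟨p, hp⟩⟩ : Fin (∑ i, a i))
      = finSigmaFinEquiv ⟨j', ⟨p', hp'⟩⟩ := by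
    ext
    rw [finSigmaFinEquiv_apply, finSigmaFinEquiv_apply]
    exact h
  exact congrArg Sigma.fst (finSigmaFinEquiv.injective h1)

lemma exists_block {p : ℕ} (hp : p < ∑ i, a i) :
    ∃ j, ∃ q < a j, (∑ i ∈ Finset.univ.filter (· < j), a i) + q = p := by
  obtain ⟨⟨j, q⟩, h⟩ := finSigmaFinEquiv.surjective (⟨p, hp⟩ : Fin (∑ i, a i))
  refine ⟨j, q, q.2, ?_⟩
  rw [sum_filter_lt_eq]
  have := congrArg Fin.val h
  rwa [finSigmaFinEquiv_apply] at this

lemma block_add_lt_sum {p : ℕ} {j : Fin n} (hp : p < a j) :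
    (∑ i ∈ Finset.univ.filter (· < j), a i) + p < ∑ i, a i := by
  have h := (finSigmaFinEquiv ⟨j, ⟨p, hp⟩⟩ : Fin (∑ i, a i)).2
  rw [finSigmaFinEquiv_apply] at h
  rwa [sum_filter_lt_eq]

end Blocks

/-! ### Combinatorics of cuts of planar trees. -/

variable {S : Type} {ar : S → ℕ}

open PlanarTree

namespace Cut

/-- A cut of the `j`-th subtree, as a cut of the whole tree. -/
def lift (deg : S → ℤ) (s : S) (ch : Fin (ar s) → PlanarTree S ar) (j : Fin (ar s))
    (c : Cut S ar) : Cut S ar where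
  upper := .node s (Function.update ch j c.upper)
  pos := (∑ i ∈ Finset.univ.filter (· < j), (ch i).leaves) + c.pos
  lower := c.lower
  sign := c.sign * (c.lower.degree deg *
    ∑ i ∈ Finset.univ.filter (j < ·), (ch i).degree deg).negOnePow

/-- A cut without its sign. -/
def key (c : Cut S ar) : PlanarTree S ar × ℕ × PlanarTree S ar := (c.upper, c.pos, c.lower)

end Cut

variable (deg : S → ℤ)

lemma cuts_node (s : S) (ch : Fin (ar s) → PlanarTree S ar) :
    cuts deg (.node s ch) = ⟨.leaf, 0, .node s ch, 1⟩ :: (List.finRange (ar s)).flatMap fun j =>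
      (cuts deg (ch j)).map (Cut.lift deg s ch j) := by
  rw [cuts]
  rfl

lemma mem_cuts_node {s : S} {ch : Fin (ar s) → PlanarTree S ar} {c : Cut S ar} :
    c ∈ cuts deg (.node s ch) ↔ c = ⟨.leaf, 0, .node s ch, 1⟩ ∨
      ∃ j, ∃ d ∈ cuts deg (ch j), Cut.lift deg s ch j d = c := by
  simp [cuts_node]

lemma mem_cuts_leaf {c : Cut S ar} : c ∈ cuts deg .leaf ↔ c = ⟨.leaf, 0, .leaf, 1⟩ := by
  simp [cuts]

variable {deg}

lemma leaf_cut_mem (T : PlanarTree S ar) : ⟨.leaf, 0, T, 1⟩ ∈ cuts deg T := by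
  cases T with
  | leaf => rw [mem_cuts_leaf]
  | node s ch => exact (mem_cuts_node deg).2 (Or.inl rfl)

lemma lift_mem {s : S} {ch : Fin (ar s) → PlanarTree S ar} {j : Fin (ar s)} {d : Cut S ar}
    (hd : d ∈ cuts deg (ch j)) : Cut.lift deg s ch j d ∈ cuts deg (.node s ch) :=
  (mem_cuts_node deg).2 (Or.inr ⟨j, d, hd, rfl⟩)

lemma sum_lt_update (f : PlanarTree S ar → ℕ) {n : ℕ} (ch : Fin n → PlanarTree S ar) (j : Fin n)
    (u : PlanarTree S ar) : ∑ i ∈ Finset.univ.filter (· < j), f (Function.update ch j u i)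
      = ∑ i ∈ Finset.univ.filter (· < j), f (ch i) := by
  refine Finset.sum_congr rfl fun i hi => ?_
  rw [Function.update_of_ne (Finset.mem_filter.1 hi).2.ne]

/-- Children to the left of `j` are untouched by the cut, so the offset can be read off the upper
part alone. This allows offsets of cuts of different trees to be compared once their upper parts
agree. -/
lemma Cut.lift_pos (s : S) (ch : Fin (ar s) → PlanarTree S ar) (j : Fin (ar s)) (c : Cut S ar) :
    (c.lift deg s ch j).pos = (∑ i ∈ Finset.univ.filter (· < j),
      (Function.update ch j c.upper i).leaves) + c.pos := by
  rw [sum_lt_update]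
  rfl

lemma pos_lt_leaves {T : PlanarTree S ar} {c : Cut S ar} (hc : c ∈ cuts deg T) :
    c.pos < c.upper.leaves := by
  induction T generalizing c with
  | leaf =>
    rw [mem_cuts_leaf] at hc
    subst hc
    exact one_pos
  | node s ch ih =>
    rcases (mem_cuts_node deg).1 hc with rfl | ⟨j, d, hd, rfl⟩
    · exact one_pos
    · rw [Cut.lift_pos]
      exact block_add_lt_sum (fun i => (Function.update ch j d.upper i).leaves)
        (by simpa using ih j hd)

/-- A tree is determined by any of its cuts. -/
lemma eq_of_mem_cuts {T T' : PlanarTree S ar} {c c' : Cut S ar} (hc : c ∈ cuts deg T)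
    (hc' : c' ∈ cuts deg T') (h : c.key = c'.key) : T = T' := by
  induction T generalizing T' c c' with
  | leaf =>
    rw [mem_cuts_leaf] at hc
    subst hc
    simp only [Cut.key, Prod.mk.injEq] at h
    cases T' with
    | leaf => rfl
    | node s' ch' =>
      rcases (mem_cuts_node deg).1 hc' with rfl | ⟨j, d, hd, rfl⟩
      · exact h.2.2
      · cases h.1
  | node s ch ih =>
    simp only [Cut.key, Prod.mk.injEq] at h
    rcases (mem_cuts_node deg).1 hc with rfl | ⟨j, d, hd, rfl⟩
    · cases T' with
      | leaf =>
        rw [mem_cuts_leaf] at hc'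
        subst hc'
        exact h.2.2
      | node s' ch' =>
        rcases (mem_cuts_node deg).1 hc' with rfl | ⟨j', d', hd', rfl⟩
        · exact h.2.2
        · cases h.1
    · cases T' with
      | leaf =>
        rw [mem_cuts_leaf] at hc'
        subst hc'
        cases h.1
      | node s' ch' =>
        rcases (mem_cuts_node deg).1 hc' with rfl | ⟨j', d', hd', rfl⟩
        · cases h.1
        · obtain ⟨h1, h2, h3⟩ := h
          rw [Cut.lift_pos, Cut.lift_pos] at h2
          obtain ⟨rfl, h1⟩ := PlanarTree.node.inj h1
          have h1 := eq_of_heq h1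
          have hlt := pos_lt_leaves hd
          have hlt' := pos_lt_leaves hd'
          rw [h1] at h2
          -- Both positions are now leaf numbers in the same upper tree, so they lie in the same
          -- block.
          obtain rfl : j = j' := by
            refine block_unique (fun i => (Function.update ch' j' d'.upper i).leaves) ?_ ?_ h2
            · rw [← h1]
              simpa using hlt
            · simpa using hlt'
          have hu : d.upper = d'.upper := by simpa using congrFun h1 j
          have hch : ch j = ch' j :=
            ih j hd hd' (by simpa [Cut.key] using ⟨hu, by omega, h3⟩)
          congr 1
          funext i
          by_cases hi : i = j
          · rw [hi, hch]
          · simpa [hi] using congrFun h1 i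

/-- Cuts in different subtrees graft at leaves in different blocks, and cuts in the same subtree are
separated by induction. Hence each graft presentation occurs once, and its coefficient in a
coproduct is a single sign. -/
lemma nodup_map_key_cuts (T : PlanarTree S ar) : ((cuts deg T).map Cut.key).Nodup := by
  induction T with
  | leaf => simp [cuts]
  | node s ch ih =>
    rw [cuts_node, List.map_cons, List.map_flatMap, List.nodup_cons, List.nodup_flatMap]
    simp only [List.map_map]
    refine ⟨?_, fun j _ => ?_, ?_⟩
    · simp [Cut.key, Cut.lift]
    · have hL : Function.Injective fun x : PlanarTree S ar × ℕ × PlanarTree S ar =>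
          (PlanarTree.node s (Function.update ch j x.1),
            (∑ i ∈ Finset.univ.filter (· < j), (ch i).leaves) + x.2.1, x.2.2) := by
        rintro ⟨u, p, v⟩ ⟨u', p', v'⟩ h
        simp only [Prod.mk.injEq, PlanarTree.node.injEq, heq_eq_eq, true_and] at h
        obtain ⟨h1, h2, h3⟩ := h
        have hu : u = u' := Function.update_injective ch j h1
        simp only [Prod.mk.injEq]
        exact ⟨hu, by omega, h3⟩
      have := (ih j).map hL
      rwa [List.map_map] at this
    · refine (List.nodup_finRange _).imp fun {j j'} hj => ?_
      intro x hx hx'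
      obtain ⟨d, hd, rfl⟩ := List.mem_map.1 hx
      obtain ⟨d', hd', h⟩ := List.mem_map.1 hx'
      simp only [Function.comp_apply, Cut.key, Prod.mk.injEq] at h
      obtain ⟨h1, h2, -⟩ := h
      have h1 := eq_of_heq (PlanarTree.node.inj h1).2
      rw [Cut.lift_pos, Cut.lift_pos, h1] at h2
      refine hj (block_unique (fun i => (Function.update ch j d.upper i).leaves) ?_ ?_ h2.symm)
      · simpa using pos_lt_leaves hd
      · rw [← h1]
        simpa using pos_lt_leaves hd'

lemma nodup_cuts (T : PlanarTree S ar) : (cuts deg T).Nodup := (nodup_map_key_cuts T).of_map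

lemma cut_eq_of_key_eq {T : PlanarTree S ar} {c c' : Cut S ar} (hc : c ∈ cuts deg T)
    (hc' : c' ∈ cuts deg T) (h : c.key = c'.key) : c = c' :=
  List.inj_on_of_nodup_map (nodup_map_key_cuts T) hc hc' h

lemma eq_of_upper_eq_leaf {T : PlanarTree S ar} {c : Cut S ar} (hc : c ∈ cuts deg T)
    (h : c.upper = .leaf) : c = ⟨.leaf, 0, T, 1⟩ := by
  cases T with
  | leaf => rwa [mem_cuts_leaf] at hc
  | node s ch =>
    rcases (mem_cuts_node deg).1 hc with rfl | ⟨j, d, hd, rfl⟩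
    · rfl
    · cases h

/-- The trivial tree has degree zero, so moving it past other vertices costs no sign. -/
lemma eq_of_lower_eq_leaf {T : PlanarTree S ar} {c : Cut S ar} (hc : c ∈ cuts deg T)
    (h : c.lower = .leaf) : c = ⟨T, c.pos, .leaf, 1⟩ := by
  induction T generalizing c with
  | leaf =>
    rw [mem_cuts_leaf] at hc
    rw [hc]
  | node s ch ih =>
    rcases (mem_cuts_node deg).1 hc with rfl | ⟨j, d, hd, rfl⟩
    · cases h
    · have h1 := ih j hd h
      rw [h1]
      simp [Cut.lift, degree]

lemma cut_leaf_mem {T : PlanarTree S ar} {p : ℕ} (hp : p < T.leaves) :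
    ⟨T, p, .leaf, 1⟩ ∈ cuts deg T := by
  induction T generalizing p with
  | leaf =>
    rw [mem_cuts_leaf]
    simp only [leaves] at hp
    simp [Nat.lt_one_iff.1 hp]
  | node s ch ih =>
    obtain ⟨j, q, hq, rfl⟩ := exists_block (fun j => (ch j).leaves) hp
    have := lift_mem (ih j hq)
    simpa [Cut.lift, degree] using this

lemma sum_update_add (f : PlanarTree S ar → ℕ) {n : ℕ} (ch : Fin n → PlanarTree S ar) (j : Fin n)
    (u : PlanarTree S ar) :
    ∑ i, f (Function.update ch j u i) + f (ch j) = ∑ i, f (ch i) + f u := by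
  rw [← Finset.add_sum_erase _ _ (Finset.mem_univ j),
    ← Finset.add_sum_erase _ (fun i => f (ch i)) (Finset.mem_univ j),
    Finset.sum_congr rfl fun i hi => by rw [Function.update_of_ne (Finset.ne_of_mem_erase hi)],
    Function.update_self]
  ring

lemma weight_add_weight {T : PlanarTree S ar} {c : Cut S ar} (hc : c ∈ cuts deg T) :
    c.upper.weight + c.lower.weight = T.weight := by
  induction T generalizing c with
  | leaf =>
    rw [mem_cuts_leaf] at hc
    subst hc
    rfl
  | node s ch ih =>
    rcases (mem_cuts_node deg).1 hc with rfl | ⟨j, d, hd, rfl⟩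
    · simp [weight]
    · have h1 := sum_update_add weight ch j d.upper
      have h2 := ih j hd
      simp only [Cut.lift, weight]
      omega

lemma eq_leaf_of_weight_eq_zero {T : PlanarTree S ar} (h : T.weight = 0) : T = .leaf := by
  cases T with
  | leaf => rfl
  | node s ch => simp [weight] at h

lemma exists_eq_corolla {T : PlanarTree S ar} (h : T.weight = 1) : ∃ s, T = corolla s := by
  cases T with
  | leaf => simp [weight] at h
  | node s ch =>
    refine ⟨s, ?_⟩
    simp only [weight, Nat.add_eq_left, Finset.sum_eq_zero_iff, Finset.mem_univ, true_imp_iff] at h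
    rw [corolla]
    congr 1
    funext i
    exact eq_leaf_of_weight_eq_zero (h i)

/-- A nontrivial tree has a topmost vertex. -/
lemma exists_lower_eq_corolla {T : PlanarTree S ar} (hT : T ≠ .leaf) :
    ∃ c ∈ cuts deg T, ∃ s, c.lower = corolla s := by
  induction T with
  | leaf => exact absurd rfl hT
  | node s ch ih =>
    by_cases h : ∀ j, ch j = .leaf
    · refine ⟨_, leaf_cut_mem _, s, ?_⟩
      exact congrArg (PlanarTree.node s) (funext h)
    · push Not at h
      obtain ⟨j, hj⟩ := h
      obtain ⟨c, hc, t, ht⟩ := ih j hj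
      exact ⟨_, lift_mem hc, t, ht⟩

/-! ### Subcooperads in coordinates: contracting one tensor factor of a coproduct. -/

section Slices

variable {k : Type*} [Field k]

/-- The contraction of the right factor with the coefficient of `V`. -/
def sliceRight (V : PlanarTree S ar) :
    TreeSpace k S ar ⊗[k] TreeSpace k S ar →ₗ[k] TreeSpace k S ar :=
  (TensorProduct.rid k _).toLinearMap ∘ₗ TensorProduct.map LinearMap.id (Finsupp.lapply V)

/-- The contraction of the left factor with the coefficient of `U`. -/
def sliceLeft (U : PlanarTree S ar) :
    TreeSpace k S ar ⊗[k] TreeSpace k S ar →ₗ[k] TreeSpace k S ar :=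
  (TensorProduct.lid k _).toLinearMap ∘ₗ TensorProduct.map (Finsupp.lapply U) LinearMap.id

lemma sliceRight_tmul (V : PlanarTree S ar) (x y : TreeSpace k S ar) :
    sliceRight V (x ⊗ₜ[k] y) = y V • x := by
  simp [sliceRight]

lemma sliceLeft_tmul (U : PlanarTree S ar) (x y : TreeSpace k S ar) :
    sliceLeft U (x ⊗ₜ[k] y) = x U • y := by
  simp [sliceLeft]

lemma sliceLeft_apply (U V : PlanarTree S ar) (z : TreeSpace k S ar ⊗[k] TreeSpace k S ar) :
    sliceLeft U z V = sliceRight V z U := by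
  induction z with
  | zero => simp
  | tmul x y => simp [sliceLeft_tmul, sliceRight_tmul, mul_comm]
  | add x y hx hy => simp [hx, hy]

lemma decomp_single (i : ℕ) (T : PlanarTree S ar) (a : k) :
    decomp deg i (Finsupp.single T a) = a • (((cuts deg T).filter fun c => c.pos = i).map fun c =>
      c.sign • (Finsupp.single c.upper (1 : k) ⊗ₜ[k] Finsupp.single c.lower (1 : k))).sum := by
  rw [decomp, Finsupp.linearCombination_single]

/-- The coefficients of the decomposition coproducts. -/
lemma sliceRight_decomp {T : PlanarTree S ar} {c : Cut S ar} (hc : c ∈ cuts deg T)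
    (x : TreeSpace k S ar) :
    sliceRight c.lower (decomp deg c.pos x) c.upper = c.sign • x T := by
  classical
  induction x using Finsupp.induction_linear with
  | zero => simp
  | add x y hx hy => simp only [map_add, Finsupp.add_apply, hx, hy, smul_add]
  | single T' a =>
    have hterm : ∀ c' : Cut S ar, sliceRight c.lower (c'.sign •
        (Finsupp.single c'.upper (1 : k) ⊗ₜ[k] Finsupp.single c'.lower (1 : k))) c.upper
        = if c'.upper = c.upper ∧ c'.lower = c.lower then c'.sign • (1 : k) else 0 := by
      intro c'
      rw [Units.smul_def, map_zsmul, sliceRight_tmul, Finsupp.smul_apply, Finsupp.smul_apply,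
        Finsupp.single_apply, Finsupp.single_apply]
      by_cases h1 : c'.upper = c.upper <;> by_cases h2 : c'.lower = c.lower <;>
        simp [h1, h2, Units.smul_def]
    rw [decomp_single, map_smul, Finsupp.smul_apply, map_list_sum, List.map_map,
      ← Finsupp.applyAddHom_apply, map_list_sum, List.map_map]
    refine (congrArg (fun l : List k => a • l.sum) (List.map_congr_left
      (g := fun c' : Cut S ar => if c'.upper = c.upper ∧ c'.lower = c.lower then
        c'.sign • (1 : k) else 0) fun c' _ => hterm c')).trans ?_
    -- If `T' = T`, exactly the cut `c` contributes. Otherwise nothing does, since the upper part,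
    -- position and lower part determine the grafted tree.
    by_cases hT : T' = T
    · subst hT
      rw [List.sum_map_eq_nsmul_single c, List.count_eq_one_of_mem]
      · simp [Units.smul_def, mul_comm]
      · exact (nodup_cuts T').filter _
      · simp [hc]
      · intro c' hne hmem
        rw [if_neg]
        rintro ⟨h1, h2⟩
        rw [List.mem_filter] at hmem
        refine hne (cut_eq_of_key_eq hmem.1 hc ?_)
        simp only [Cut.key, Prod.mk.injEq]
        exact ⟨h1, by simpa using hmem.2, h2⟩
    · rw [Finsupp.single_eq_of_ne (Ne.symm hT), smul_zero, List.sum_eq_zero, smul_zero]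
      intro y hy
      obtain ⟨c', hc', rfl⟩ := List.mem_map.1 hy
      rw [List.mem_filter] at hc'
      rw [if_neg]
      rintro ⟨h1, h2⟩
      refine hT (eq_of_mem_cuts hc'.1 hc ?_)
      simp only [Cut.key, Prod.mk.injEq]
      exact ⟨h1, by simpa using hc'.2, h2⟩

variable {Q : Submodule k (TreeSpace k S ar)}

lemma sliceRight_mem (V : PlanarTree S ar) {z : TreeSpace k S ar ⊗[k] TreeSpace k S ar}
    (hz : z ∈ LinearMap.range (TensorProduct.map Q.subtype Q.subtype)) : sliceRight V z ∈ Q := by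
  obtain ⟨w, rfl⟩ := hz
  induction w with
  | zero => simp
  | tmul x y =>
    rw [TensorProduct.map_tmul, sliceRight_tmul]
    exact Q.smul_mem _ x.2
  | add x y hx hy =>
    rw [map_add, map_add]
    exact Q.add_mem hx hy

lemma sliceLeft_mem (U : PlanarTree S ar) {z : TreeSpace k S ar ⊗[k] TreeSpace k S ar}
    (hz : z ∈ LinearMap.range (TensorProduct.map Q.subtype Q.subtype)) : sliceLeft U z ∈ Q := by
  obtain ⟨w, rfl⟩ := hz
  induction w with
  | zero => simp
  | tmul x y =>
    rw [TensorProduct.map_tmul, sliceLeft_tmul]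
    exact Q.smul_mem _ y.2
  | add x y hx hy =>
    rw [map_add, map_add]
    exact Q.add_mem hx hy

/-- The element is the contraction of the coproduct of `x` against `V`; it lies in `Q` because the
coproduct lies in `Q ⊗ Q`. -/
lemma IsSubcooperad.exists_right (hQ : IsSubcooperad deg Q) {x : TreeSpace k S ar} (hx : x ∈ Q)
    (p : ℕ) (V : PlanarTree S ar) : ∃ y ∈ Q, ∀ T, ∀ c ∈ cuts deg T, c.pos = p → c.lower = V →
      y c.upper = c.sign • x T := by
  refine ⟨sliceRight V (decomp deg p x), sliceRight_mem V (hQ.decomp_mem p x hx), ?_⟩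
  rintro T c hc rfl rfl
  exact sliceRight_decomp hc x

lemma IsSubcooperad.exists_left (hQ : IsSubcooperad deg Q) {x : TreeSpace k S ar} (hx : x ∈ Q)
    (p : ℕ) (U : PlanarTree S ar) : ∃ y ∈ Q, ∀ T, ∀ c ∈ cuts deg T, c.pos = p → c.upper = U →
      y c.lower = c.sign • x T := by
  refine ⟨sliceLeft U (decomp deg p x), sliceLeft_mem U (hQ.decomp_mem p x hx), ?_⟩
  rintro T c hc rfl rfl
  rw [sliceLeft_apply]
  exact sliceRight_decomp hc x

end Slices

open PlanarTree

/-! ### Planar `n`-ary trees with at most three vertices and their cuts. -/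

section Mock

variable {n : ℕ}

/-- Planar `n`-ary trees. -/
abbrev NTree (n : ℕ) : Type := PlanarTree Unit fun _ => n

/-- The `n`-ary corolla. -/
abbrev cor (n : ℕ) : NTree n := corolla ()

/-- The tree with two vertices whose upper vertex is at the input `i` of the root. -/
abbrev cc (i : Fin n) : NTree n := corollaComp () i ()

/-- The tree `μ ∘ᵢ (μ ∘ⱼ μ)`. -/
abbrev chain (i j : Fin n) : NTree n :=
  .node () (Function.update (fun _ => .leaf) i (cc j))

/-- The children of the root of `cherry i j`. -/
def cherryChildren (i j : Fin n) : Fin n → NTree n :=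
  Function.update (Function.update (fun _ => .leaf) i (cor n)) j (cor n)

lemma cherryChildren_left {i j : Fin n} (hij : i < j) : cherryChildren i j i = cor n := by
  simp [cherryChildren, hij.ne]

lemma cherryChildren_right (i j : Fin n) : cherryChildren i j j = cor n := by
  simp [cherryChildren]

lemma cherryChildren_of_ne {i j l : Fin n} (hi : l ≠ i) (hj : l ≠ j) :
    cherryChildren i j l = .leaf := by
  simp [cherryChildren, hi, hj]

/-- The tree with a corolla at the inputs `i` and `j` of the root. -/
abbrev cherry (i j : Fin n) : NTree n := .node () (cherryChildren i j)

/-- The generator has degree one. -/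
abbrev degOne : Unit → ℤ := fun _ => 1

lemma weight_cor : (cor n).weight = 1 := by simp [corolla, weight]

lemma leaves_cor : (cor n).leaves = n := by simp [corolla, leaves]

lemma leaves_eq (hn : 1 ≤ n) (T : NTree n) : T.leaves = 1 + (n - 1) * T.weight := by
  induction T with
  | leaf => rfl
  | node s ch ih =>
    simp only [leaves, weight, ih, Finset.sum_add_distrib, Finset.sum_const, Finset.card_univ,
      Fintype.card_fin, ← Finset.mul_sum, smul_eq_mul, mul_one, mul_add]
    omega

lemma degree_eq (T : NTree n) : T.degree degOne = T.weight := by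
  induction T with
  | leaf => rfl
  | node s ch ih =>
    simp only [degree, weight, ih]
    push_cast
    rfl

lemma cc_injective : Function.Injective (cc : Fin n → NTree n) := by
  intro i j h
  have h1 := congrFun (eq_of_heq (PlanarTree.node.inj h).2) i
  by_contra hne
  rw [Function.update_self, Function.update_of_ne hne] at h1
  cases h1

lemma sum_filter_lt_one (i : Fin n) : ∑ _l ∈ Finset.univ.filter (· < i), 1 = (i : ℕ) := by
  rw [sum_filter_lt_eq fun _ => 1]
  simp

/-- Cutting above the input `i` of the root, when the other inputs on the left are leaves. -/
lemma lift_eq {ch : Fin n → NTree n} {i : Fin n} (hl : ∀ l, l < i → ch l = .leaf)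
    (hr : ∀ l, i < l → ch l = .leaf) (c : Cut Unit fun _ => n) :
    Cut.lift degOne () ch i c
      = ⟨.node () (Function.update ch i c.upper), i + c.pos, c.lower, c.sign⟩ := by
  have h1 : ∑ l ∈ Finset.univ.filter (· < i), (ch l).leaves = (i : ℕ) := by
    rw [← sum_filter_lt_one i]
    exact Finset.sum_congr rfl fun l hlm => by rw [hl l (Finset.mem_filter.1 hlm).2]; rfl
  have h2 : ∑ l ∈ Finset.univ.filter (i < ·), (ch l).degree degOne = 0 :=
    Finset.sum_eq_zero fun l hlm => by rw [hr l (Finset.mem_filter.1 hlm).2]; rfl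
  simp [Cut.lift, h1, h2]

lemma chain_cut_lower (i j : Fin n) : ⟨cor n, i, cc j, 1⟩ ∈ cuts degOne (chain i j) := by
  have h := lift_mem (deg := degOne) (s := ()) (ar := fun _ => n)
    (ch := Function.update (fun _ => .leaf) i (cc j)) (j := i) (d := ⟨.leaf, 0, cc j, 1⟩)
    (by simpa using leaf_cut_mem _)
  rw [lift_eq (fun l hl => by simp [hl.ne]) (fun l hl => by simp [hl.ne'])] at h
  simp only [Function.update_idem, add_zero] at h
  rwa [Function.update_eq_self_iff.2 rfl] at h

lemma cc_cut (j : Fin n) : ⟨cor n, j, cor n, 1⟩ ∈ cuts degOne (cc j) := by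
  have h := lift_mem (deg := degOne) (s := ()) (ar := fun _ => n)
    (ch := Function.update (fun _ => .leaf) j (cor n)) (j := j) (d := ⟨.leaf, 0, cor n, 1⟩)
    (by simpa using leaf_cut_mem _)
  rw [lift_eq (fun l hl => by simp [hl.ne]) (fun l hl => by simp [hl.ne'])] at h
  simp only [Function.update_idem, add_zero] at h
  rwa [Function.update_eq_self_iff.2 rfl] at h

lemma chain_cut_upper (i j : Fin n) : ⟨cc i, i + j, cor n, 1⟩ ∈ cuts degOne (chain i j) := by
  have h := lift_mem (deg := degOne) (s := ()) (ar := fun _ => n)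
    (ch := Function.update (fun _ => .leaf) i (cc j)) (j := i) (d := ⟨cor n, j, cor n, 1⟩)
    (by simpa using cc_cut j)
  rw [lift_eq (fun l hl => by simp [hl.ne]) (fun l hl => by simp [hl.ne'])] at h
  simp only [Function.update_idem] at h
  exact h

/-- The left corolla has `n` leaves instead of one, which shifts the position by `n - 1`. Only
leaves lie to the right of `j`, so the sign is trivial. -/
lemma cherry_cut_right {i j : Fin n} (hij : i < j) :
    ⟨cc i, j + (n - 1), cor n, 1⟩ ∈ cuts degOne (cherry i j) := by
  have h := lift_mem (deg := degOne) (s := ()) (ar := fun _ => n) (ch := cherryChildren i j)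
    (j := j) (d := ⟨.leaf, 0, cor n, 1⟩)
    (by rw [cherryChildren_right]; exact leaf_cut_mem _)
  have hpos : ∑ l ∈ Finset.univ.filter (· < j), (cherryChildren i j l).leaves = j + (n - 1) := by
    have hi : i ∈ Finset.univ.filter (· < j) := by simpa using hij
    have h1 := sum_filter_lt_one j
    rw [← Finset.add_sum_erase _ _ hi] at h1 ⊢
    rw [Finset.sum_congr rfl (g := fun _ => 1) (fun l hl => by
        rw [cherryChildren_of_ne (Finset.ne_of_mem_erase hl)
          (Finset.mem_filter.1 (Finset.mem_of_mem_erase hl)).2.ne]; rfl),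
      cherryChildren_left hij, leaves_cor]
    have := i.2
    omega
  have hdeg : ∑ l ∈ Finset.univ.filter (j < ·), (cherryChildren i j l).degree degOne = 0 :=
    Finset.sum_eq_zero fun l hlm => by
      have hl := (Finset.mem_filter.1 hlm).2
      rw [cherryChildren_of_ne (hij.trans hl).ne' hl.ne']
      rfl
  simp only [Cut.lift, hpos, hdeg, mul_zero, Int.negOnePow_zero, mul_one, add_zero] at h
  have hu : Function.update (cherryChildren i j) j .leaf
      = Function.update (fun _ => .leaf) i (cor n) := by
    rw [cherryChildren, Function.update_idem, Function.update_eq_self_iff]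
    simp [hij.ne']
  rw [hu] at h
  exact h

/-- The left corolla has to move past the right one, and both have degree one. This sign is what
makes weight three vanish. -/
lemma cherry_cut_left {i j : Fin n} (hij : i < j) :
    ⟨cc j, i, cor n, -1⟩ ∈ cuts degOne (cherry i j) := by
  have h := lift_mem (deg := degOne) (s := ()) (ar := fun _ => n) (ch := cherryChildren i j)
    (j := i) (d := ⟨.leaf, 0, cor n, 1⟩)
    (by rw [cherryChildren_left hij]; exact leaf_cut_mem _)
  have hpos : ∑ l ∈ Finset.univ.filter (· < i), (cherryChildren i j l).leaves = i := by
    rw [← sum_filter_lt_one i]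
    refine Finset.sum_congr rfl fun l hlm => ?_
    have hl := (Finset.mem_filter.1 hlm).2
    rw [cherryChildren_of_ne hl.ne (hl.trans hij).ne]
    rfl
  have hcor : (cor n).degree degOne = 1 := by
    rw [degree_eq, weight_cor]
    rfl
  have hdeg : ∑ l ∈ Finset.univ.filter (i < ·), (cherryChildren i j l).degree degOne = 1 := by
    rw [Finset.sum_eq_single j]
    · rw [cherryChildren_right, hcor]
    · intro l hlm hne
      rw [cherryChildren_of_ne (Finset.mem_filter.1 hlm).2.ne' hne]
      rfl
    · simp [hij]
  simp only [Cut.lift, hpos, hdeg, hcor, mul_one, add_zero, one_mul, Int.negOnePow_one] at h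
  have hu : Function.update (cherryChildren i j) i .leaf
      = Function.update (fun _ => .leaf) j (cor n) := by
    rw [cherryChildren, Function.update_comm hij.ne, Function.update_idem,
      Function.update_eq_self_iff]
    simp [hij.ne]
  rw [hu] at h
  exact h

end Mock

open PlanarTree

/-! ### Trees of weight at most two and the span of their sums. -/

section Mock

variable {n : ℕ}

lemma eq_cor {T : NTree n} (h : T.weight = 1) : T = cor n := by
  obtain ⟨s, rfl⟩ := exists_eq_corolla h
  rfl

lemma weight_cc (i : Fin n) : (cc i).weight = 2 := weight_corollaComp _ _ _

lemma leaves_cc (i : Fin n) : (cc i).leaves = (n - 1) + n := leaves_corollaComp _ _ _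

/-- A tree of positive weight is obtained by grafting a corolla onto a smaller tree. -/
lemma exists_cut_cor {T : NTree n} {w : ℕ} (hT : T.weight = w + 1) :
    ∃ c ∈ cuts degOne T, c.lower = cor n ∧ c.upper.weight = w := by
  obtain ⟨c, hc, s, hs⟩ := exists_lower_eq_corolla (deg := degOne) (T := T)
    (by rintro rfl; simp [weight] at hT)
  have h := weight_add_weight hc
  rw [hs, hT] at h
  have h1 : (corolla s : NTree n).weight = 1 := weight_cor
  exact ⟨c, hc, hs, by omega⟩

lemma eq_cc_of_cut {T : NTree n} {c : Cut Unit fun _ => n} (hc : c ∈ cuts degOne T)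
    (hu : c.upper = cor n) (hl : c.lower = cor n) : ∃ i : Fin n, (i : ℕ) = c.pos ∧ T = cc i := by
  have hp := pos_lt_leaves hc
  rw [hu, leaves_cor] at hp
  exact ⟨⟨c.pos, hp⟩, rfl, eq_of_mem_cuts hc (cc_cut _) (by simp [Cut.key, hu, hl])⟩

lemma exists_eq_cc {T : NTree n} (h : T.weight = 2) : ∃ i, T = cc i := by
  obtain ⟨c, hc, hl, hu⟩ := exists_cut_cor h
  obtain ⟨i, -, hi⟩ := eq_cc_of_cut hc (eq_cor hu) hl
  exact ⟨i, hi⟩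

variable (k : Type*) [Field k]

/-- The sum of all `μ ∘ᵢ μ`. -/
def relator (n : ℕ) : TreeSpace k Unit fun _ => n :=
  ∑ i : Fin n, Finsupp.single (cc i) (1 : k)

/-- The sum of all trees of weight `w`, for `w ≤ 2`. -/
def treeSum (n : ℕ) : Fin 3 → TreeSpace k Unit fun _ => n :=
  ![Finsupp.single .leaf 1, Finsupp.single (cor n) 1, relator k n]

lemma relator_apply_cc (i : Fin n) : relator k n (cc i) = 1 := by
  rw [relator, Finsupp.finsetSum_apply, Finset.sum_eq_single i]
  · simp
  · intro j _ hj
    exact Finsupp.single_eq_of_ne fun h => hj (cc_injective h).symm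
  · simp

lemma treeSum_apply (w : Fin 3) (T : NTree n) :
    treeSum k n w T = if T.weight = w then 1 else 0 := by
  classical
  fin_cases w
  · change Finsupp.single (leaf : NTree n) (1 : k) T = if T.weight = 0 then 1 else 0
    rw [Finsupp.single_apply]
    refine if_congr ⟨?_, fun h => (eq_leaf_of_weight_eq_zero h).symm⟩ rfl rfl
    rintro rfl
    rfl
  · change Finsupp.single (cor n) (1 : k) T = if T.weight = 1 then 1 else 0
    rw [Finsupp.single_apply]
    refine if_congr ⟨?_, fun h => (eq_cor h).symm⟩ rfl rfl
    rintro rfl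
    exact weight_cor
  · change relator k n T = if T.weight = 2 then 1 else 0
    split_ifs with h
    · obtain ⟨i, rfl⟩ := exists_eq_cc h
      exact relator_apply_cc k i
    · rw [relator, Finsupp.finsetSum_apply]
      refine Finset.sum_eq_zero fun i _ => Finsupp.single_eq_of_ne ?_
      rintro rfl
      exact h (weight_cc i)

/-- The span of the trivial tree, the corolla and the relator. -/
def mockSpan (n : ℕ) : Submodule k (TreeSpace k Unit fun _ => n) :=
  Submodule.span k (Set.range (treeSum k n))

variable {k}

lemma mem_mockSpan_iff {x : TreeSpace k Unit fun _ => n} :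
    x ∈ mockSpan k n ↔ ∃ a : Fin 3 → k, ∑ w, a w • treeSum k n w = x := by
  rw [mockSpan, Submodule.mem_span_range_iff_exists_fun]

lemma sum_treeSum_apply (a : Fin 3 → k) (w : Fin 3) {T : NTree n} (hT : T.weight = w) :
    (∑ w, a w • treeSum k n w) T = a w := by
  rw [Finsupp.finsetSum_apply, Finset.sum_eq_single w]
  · rw [Finsupp.smul_apply, treeSum_apply, if_pos hT, smul_eq_mul, mul_one]
  · intro v _ hv
    rw [Finsupp.smul_apply, treeSum_apply, if_neg, smul_zero]
    rw [hT]
    exact fun h => hv (Fin.ext h.symm)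
  · simp

lemma sum_treeSum_apply_of_le (a : Fin 3 → k) {T : NTree n} (hT : 3 ≤ T.weight) :
    (∑ w, a w • treeSum k n w) T = 0 := by
  rw [Finsupp.finsetSum_apply]
  refine Finset.sum_eq_zero fun w _ => ?_
  rw [Finsupp.smul_apply, treeSum_apply, if_neg, smul_zero]
  have := w.2
  omega

/-! ### Upper bound: every admissible subcooperad lies in the span. -/

section Upper

variable {Q : Submodule k (TreeSpace k Unit fun _ => n)}

lemma apply_cc_eq (hrel : ∀ x ∈ Q, weightPart 2 x ∈ Submodule.span k {relator k n})
    {x : TreeSpace k Unit fun _ => n} (hx : x ∈ Q) (i j : Fin n) : x (cc i) = x (cc j) := by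
  obtain ⟨a, ha⟩ := Submodule.mem_span_singleton.1 (hrel x hx)
  have h : ∀ i, x (cc i) = a := by
    intro i
    have h1 := DFunLike.congr_fun ha (cc i)
    rw [Finsupp.smul_apply, relator_apply_cc, weightPart,
      Finsupp.filter_apply_pos (fun T : NTree n => T.weight = 2) _ (weight_cc i)] at h1
    rw [← h1, smul_eq_mul, mul_one]
  rw [h, h]

/-- There is nothing in weight three. -/
lemma apply_eq_zero_of_weight_eq_three [NeZero (2 : k)] (hn : 2 ≤ n) (hQ : IsSubcooperad degOne Q)
    (hrel : ∀ x ∈ Q, weightPart 2 x ∈ Submodule.span k {relator k n})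
    {x : TreeSpace k Unit fun _ => n} (hx : x ∈ Q) {T : NTree n} (hT : T.weight = 3) :
    x T = 0 := by
  -- Removing the root corolla leaves a weight two coefficient, which does not depend on `j`.
  have hlow : ∀ i j j' : Fin n, x (chain i j) = x (chain i j') := by
    intro i j j'
    obtain ⟨y, hy, h⟩ := hQ.exists_left hx i (cor n)
    have h1 := h _ _ (chain_cut_lower i j) rfl rfl
    have h2 := h _ _ (chain_cut_lower i j') rfl rfl
    rw [one_smul] at h1 h2
    rw [← h1, ← h2]
    exact apply_cc_eq hrel hy _ _
  -- `y p` records the coefficients of `x` at trees obtained by grafting a corolla at leaf `p`; by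
  -- the relation it is constant on trees of weight two.
  choose y hy hyc using fun p : ℕ => hQ.exists_right hx p (cor n)
  have hcc : ∀ p (i j : Fin n), y p (cc i) = y p (cc j) :=
    fun p => apply_cc_eq hrel (hy p)
  have hchain : ∀ i j : Fin n, y (i + j) (cc i) = x (chain i j) := by
    intro i j
    have := hyc _ _ _ (chain_cut_upper i j) rfl rfl
    rwa [one_smul] at this
  have hleft : ∀ i j : Fin n, i < j → y i (cc j) = -x (cherry i j) := by
    intro i j hij
    have := hyc _ _ _ (cherry_cut_left hij) rfl rfl
    rwa [Units.neg_smul, one_smul] at this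
  have hright : ∀ i j : Fin n, i < j → y (j + (n - 1)) (cc i) = x (cherry i j) := by
    intro i j hij
    have := hyc _ _ _ (cherry_cut_right hij) rfl rfl
    rwa [one_smul] at this
  -- For the first and last inputs, leaf `2 * (n - 1)` relates `cherry o m` to `chain m m`, leaf `n
  -- - 1` relates `chain m o` to `chain o m`, and leaf `0` relates `chain o o` to `-cherry o m`.
  -- With `hlow` this closes a cycle with total sign `-1`.
  let o : Fin n := ⟨0, by omega⟩
  let m : Fin n := ⟨n - 1, by omega⟩
  have hom : o < m := by
    change 0 < n - 1
    omega
  have e1 : x (cherry o m) = x (chain m m) := by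
    rw [← hright o m hom, hcc _ o m]
    exact hchain m m
  have e2 : x (chain m o) = x (chain o m) := by
    rw [← hchain m o, ← hchain o m, hcc _ m o, Nat.add_comm]
  have e3 : x (chain o o) = -x (cherry o m) := by
    rw [← hleft o m hom, ← hchain o o, hcc _ o m]
    rfl
  have e4 : x (chain o m) = 0 := by
    have h1 : x (cherry o m) = -x (cherry o m) := by
      rw [← e3, e1, hlow m m o, e2, hlow o m o]
    have h2 : 2 * x (cherry o m) = 0 := by linear_combination h1
    have h3 := (mul_eq_zero.1 h2).resolve_left two_ne_zero
    rw [hlow o m o, e3, h3, neg_zero]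
  have hzero : ∀ i j : Fin n, x (chain i j) = 0 := by
    intro i j
    -- Choosing the second input as `n - 1 - i` puts the top corolla at leaf `n - 1`, as in `chain o
    -- m`.
    rw [hlow i j ⟨n - 1 - i, by omega⟩, ← hchain, hcc _ i o]
    have h1 : (i : ℕ) + ((⟨n - 1 - i, by omega⟩ : Fin n) : ℕ) = o + m := by
      have := i.2
      change (i : ℕ) + (n - 1 - i) = 0 + (n - 1)
      omega
    rw [h1, hchain, e4]
  -- An arbitrary tree of weight three is a corolla grafted at some leaf of a tree `cc i`. Every
  -- leaf number below `2 * n - 1` is already reached by a chain starting at `o` or at `m`.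
  obtain ⟨c, hc, hl, hu⟩ := exists_cut_cor hT
  obtain ⟨i, hi⟩ := exists_eq_cc hu
  have hp := pos_lt_leaves hc
  rw [hi, leaves_cc] at hp
  have h1 := hyc _ T c hc rfl hl
  have h2 : y c.pos c.upper = 0 := by
    rw [hi]
    rcases le_total c.pos (n - 1) with h | h
    · rw [hcc _ i o]
      have := hchain o ⟨c.pos, by omega⟩
      rw [hzero] at this
      simpa [o] using this
    · rw [hcc _ i m]
      have := hchain m ⟨c.pos - (n - 1), by omega⟩
      rw [hzero] at this
      simpa [m, h] using this
  rw [h2] at h1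
  rcases Int.units_eq_one_or c.sign with hs | hs
  · rw [hs, one_smul] at h1
    exact h1.symm
  · rw [hs, Units.neg_smul, one_smul] at h1
    exact neg_eq_zero.1 h1.symm

lemma apply_eq_zero_of_three_le_weight [NeZero (2 : k)] (hn : 2 ≤ n) (hQ : IsSubcooperad degOne Q)
    (hrel : ∀ x ∈ Q, weightPart 2 x ∈ Submodule.span k {relator k n})
    {x : TreeSpace k Unit fun _ => n} (hx : x ∈ Q) {T : NTree n} (hT : 3 ≤ T.weight) :
    x T = 0 := by
  obtain ⟨w, hw⟩ := Nat.exists_eq_add_of_le hT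
  induction w generalizing x T with
  | zero => exact apply_eq_zero_of_weight_eq_three hn hQ hrel hx hw
  | succ w ih =>
    -- Removing a top corolla lowers the weight by one and stays inside `Q`.
    obtain ⟨c, hc, hl, hu⟩ := exists_cut_cor hw
    obtain ⟨y, hy, hyc⟩ := hQ.exists_right hx c.pos (cor n)
    have h1 := hyc T c hc rfl hl
    rw [ih hy (by rw [hu]; exact Nat.le_add_right 3 w) hu] at h1
    rcases Int.units_eq_one_or c.sign with hs | hs
    · rw [hs, one_smul] at h1
      exact h1.symm
    · rw [hs, Units.neg_smul, one_smul] at h1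
      exact neg_eq_zero.1 h1.symm

lemma le_mockSpan [NeZero (2 : k)] (hn : 2 ≤ n) (hQ : IsSubcooperad degOne Q)
    (hrel : ∀ x ∈ Q, weightPart 2 x ∈ Submodule.span k {relator k n}) : Q ≤ mockSpan k n := by
  intro x hx
  let o : Fin n := ⟨0, by omega⟩
  let a : Fin 3 → k := ![x .leaf, x (cor n), x (cc o)]
  refine mem_mockSpan_iff.2 ⟨a, Finsupp.ext fun T => ?_⟩
  rcases lt_or_ge T.weight 3 with h | h
  · obtain h' | h' | h' : T.weight = 0 ∨ T.weight = 1 ∨ T.weight = 2 := by omega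
    · rw [sum_treeSum_apply a 0 h', eq_leaf_of_weight_eq_zero h']
      rfl
    · rw [sum_treeSum_apply a 1 h', eq_cor h']
      rfl
    · rw [sum_treeSum_apply a 2 h']
      obtain ⟨i, rfl⟩ := exists_eq_cc h'
      exact apply_cc_eq hrel hx o i
  · rw [sum_treeSum_apply_of_le a h, apply_eq_zero_of_three_le_weight hn hQ hrel hx h]

end Upper

/-! ### Lower bound: the span is a subcooperad satisfying the weight two condition. -/

section Lower

lemma mem_tensor {Q : Submodule k (TreeSpace k Unit fun _ => n)}
    {x y : TreeSpace k Unit fun _ => n} (hx : x ∈ Q) (hy : y ∈ Q) :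
    x ⊗ₜ[k] y ∈ LinearMap.range (TensorProduct.map Q.subtype Q.subtype) :=
  ⟨⟨x, hx⟩ ⊗ₜ ⟨y, hy⟩, rfl⟩

/-- Allows the recursive enumeration of cuts to be replaced by any explicit list without repetitions
and with the same members. -/
lemma decomp_single_eq {p : ℕ} {T : NTree n} {l : List (Cut Unit fun _ => n)} (hl : l.Nodup)
    (h : ∀ c, c ∈ cuts degOne T ∧ c.pos = p ↔ c ∈ l) :
    decomp degOne p (Finsupp.single T (1 : k)) = (l.map fun c =>
      c.sign • (Finsupp.single c.upper (1 : k) ⊗ₜ[k] Finsupp.single c.lower (1 : k))).sum := by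
  rw [decomp_single, one_smul]
  refine List.Perm.sum_eq (List.Perm.map _ ?_)
  refine (List.perm_ext_iff_of_nodup ((nodup_cuts T).filter _) hl).2 fun c => ?_
  rw [← h]
  simp

lemma cut_cases {T : NTree n} (hT : T.weight ≤ 2) {c : Cut Unit fun _ => n}
    (hc : c ∈ cuts degOne T) : c = ⟨.leaf, 0, T, 1⟩ ∨ c = ⟨T, c.pos, .leaf, 1⟩ ∨
      ∃ i : Fin n, T = cc i ∧ c = ⟨cor n, i, cor n, 1⟩ := by
  have hw := weight_add_weight hc
  by_cases hu : c.upper.weight = 0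
  · exact Or.inl (eq_of_upper_eq_leaf hc (eq_leaf_of_weight_eq_zero hu))
  by_cases hl : c.lower.weight = 0
  · exact Or.inr (Or.inl (eq_of_lower_eq_leaf hc (eq_leaf_of_weight_eq_zero hl)))
  have hu' := eq_cor (show c.upper.weight = 1 by omega)
  have hl' := eq_cor (show c.lower.weight = 1 by omega)
  obtain ⟨i, hi, rfl⟩ := eq_cc_of_cut hc hu' hl'
  refine Or.inr (Or.inr ⟨i, rfl, cut_eq_of_key_eq hc (cc_cut i) ?_⟩)
  simp [Cut.key, hu', hl', hi]

lemma mem_ite_singleton {α : Type*} {P : Prop} [Decidable P] {a b : α} :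
    a ∈ (if P then [b] else []) ↔ P ∧ a = b := by
  split_ifs with h <;> simp [h]

/-- For the trivial tree the two kinds of trivial cut coincide, so there is one term rather than
two. -/
lemma decomp_leaf (p : ℕ) : decomp degOne p (Finsupp.single (.leaf : NTree n) (1 : k))
    = if p = 0 then Finsupp.single .leaf 1 ⊗ₜ[k] Finsupp.single .leaf 1 else 0 := by
  rw [decomp_single_eq (l := if p = 0 then [⟨.leaf, 0, .leaf, 1⟩] else [])]
  · split_ifs <;> simp
  · split_ifs <;> simp
  · intro c
    rw [mem_cuts_leaf, mem_ite_singleton]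
    constructor
    · rintro ⟨rfl, rfl⟩
      exact ⟨rfl, rfl⟩
    · rintro ⟨rfl, rfl⟩
      exact ⟨rfl, rfl⟩

lemma decomp_cor (p : ℕ) : decomp degOne p (Finsupp.single (cor n) (1 : k))
    = (if p = 0 then Finsupp.single .leaf 1 ⊗ₜ[k] Finsupp.single (cor n) 1 else 0)
      + if p < n then Finsupp.single (cor n) 1 ⊗ₜ[k] Finsupp.single .leaf 1 else 0 := by
  rw [decomp_single_eq (l := (if p = 0 then [⟨.leaf, 0, cor n, 1⟩] else [])
    ++ if p < n then [⟨cor n, p, .leaf, 1⟩] else [])]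
  · split_ifs <;> simp
  · split_ifs <;> simp [corolla]
  · intro c
    have h1 : c ∈ ((if p = 0 then [⟨.leaf, 0, cor n, 1⟩] else [])
        ++ if p < n then [⟨cor n, p, .leaf, 1⟩] else [] : List (Cut Unit fun _ => n)) ↔
        (p = 0 ∧ c = ⟨.leaf, 0, cor n, 1⟩) ∨ (p < n ∧ c = ⟨cor n, p, .leaf, 1⟩) := by
      simp only [List.mem_append, mem_ite_singleton]
    rw [h1]
    constructor
    · rintro ⟨hc, rfl⟩
      have hp := pos_lt_leaves hc
      rcases cut_cases (weight_cor.trans_le one_le_two) hc with h | h | ⟨i, h, -⟩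
      · rw [h]
        simp
      · rw [h] at hp
        exact Or.inr ⟨by rwa [leaves_cor] at hp, h⟩
      · have := congrArg weight h
        rw [weight_cor, weight_cc] at this
        omega
    · rintro (⟨rfl, rfl⟩ | ⟨hp, rfl⟩)
      · exact ⟨leaf_cut_mem _, rfl⟩
      · exact ⟨cut_leaf_mem (by rwa [leaves_cor]), rfl⟩

lemma decomp_cc (p : ℕ) (i : Fin n) : decomp degOne p (Finsupp.single (cc i) (1 : k))
    = (if p = 0 then Finsupp.single .leaf 1 ⊗ₜ[k] Finsupp.single (cc i) 1 else 0)
      + (if p < (n - 1) + n then Finsupp.single (cc i) 1 ⊗ₜ[k] Finsupp.single .leaf 1 else 0)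
      + if p = i then Finsupp.single (cor n) 1 ⊗ₜ[k] Finsupp.single (cor n) 1 else 0 := by
  rw [decomp_single_eq (l := (if p = 0 then [⟨.leaf, 0, cc i, 1⟩] else [])
    ++ (if p < (n - 1) + n then [⟨cc i, p, .leaf, 1⟩] else [])
    ++ if p = i then [⟨cor n, p, cor n, 1⟩] else [])]
  · split_ifs <;> simp [add_assoc]
  · split_ifs <;> simp [corolla, corollaComp]
  · intro c
    have h1 : c ∈ ((if p = 0 then [⟨.leaf, 0, cc i, 1⟩] else [])
        ++ (if p < (n - 1) + n then [⟨cc i, p, .leaf, 1⟩] else [])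
        ++ if p = i then [⟨cor n, p, cor n, 1⟩] else [] : List (Cut Unit fun _ => n)) ↔
        (p = 0 ∧ c = ⟨.leaf, 0, cc i, 1⟩) ∨ (p < (n - 1) + n ∧ c = ⟨cc i, p, .leaf, 1⟩) ∨
          (p = i ∧ c = ⟨cor n, p, cor n, 1⟩) := by
      simp only [List.mem_append, mem_ite_singleton, or_assoc]
    rw [h1]
    constructor
    · rintro ⟨hc, rfl⟩
      have hp := pos_lt_leaves hc
      rcases cut_cases (weight_cc i).le hc with h | h | ⟨j, hj, h⟩
      · rw [h]
        simp
      · rw [h] at hp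
        exact Or.inr (Or.inl ⟨by rwa [leaves_cc] at hp, h⟩)
      · obtain rfl := cc_injective hj
        rw [h]
        simp
    · rintro (⟨rfl, rfl⟩ | ⟨hp, rfl⟩ | ⟨rfl, rfl⟩)
      · exact ⟨leaf_cut_mem _, rfl⟩
      · exact ⟨cut_leaf_mem (by rwa [leaves_cc]), rfl⟩
      · exact ⟨cc_cut i, rfl⟩

lemma treeSum_mem (w : Fin 3) : treeSum k n w ∈ mockSpan k n :=
  Submodule.subset_span (Set.mem_range_self w)

lemma decomp_treeSum_mem (p : ℕ) (w : Fin 3) : decomp degOne p (treeSum k n w) ∈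
    LinearMap.range (TensorProduct.map (mockSpan k n).subtype (mockSpan k n).subtype) := by
  have h0 : Finsupp.single .leaf 1 ∈ mockSpan k n := treeSum_mem 0
  have h1 : Finsupp.single (cor n) 1 ∈ mockSpan k n := treeSum_mem 1
  have h2 : relator k n ∈ mockSpan k n := treeSum_mem 2
  have hite : ∀ (P : Prop) [Decidable P] {z : (TreeSpace k Unit fun _ => n) ⊗[k] _},
      z ∈ LinearMap.range (TensorProduct.map (mockSpan k n).subtype (mockSpan k n).subtype) →
      (if P then z else 0) ∈
        LinearMap.range (TensorProduct.map (mockSpan k n).subtype (mockSpan k n).subtype) := by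
    intro P _ z hz
    split_ifs
    · exact hz
    · exact Submodule.zero_mem _
  fin_cases w
  · change decomp degOne p (Finsupp.single .leaf 1) ∈ _
    rw [decomp_leaf]
    exact hite _ (mem_tensor h0 h0)
  · change decomp degOne p (Finsupp.single (cor n) 1) ∈ _
    rw [decomp_cor]
    exact Submodule.add_mem _ (hite _ (mem_tensor h0 h1)) (hite _ (mem_tensor h1 h0))
  · change decomp degOne p (relator k n) ∈ _
    -- The individual trees `cc i` need not lie in the span; only after summing over `i` do the
    -- trivial cuts reassemble into tensors with the relator.
    have h : decomp degOne p (relator k n)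
        = (if p = 0 then Finsupp.single .leaf 1 ⊗ₜ[k] relator k n else 0)
        + (if p < (n - 1) + n then relator k n ⊗ₜ[k] Finsupp.single .leaf 1 else 0)
        + ∑ i : Fin n, if p = i then Finsupp.single (cor n) 1 ⊗ₜ[k] Finsupp.single (cor n) 1
          else 0 := by
      rw [relator, map_sum]
      simp only [decomp_cc, Finset.sum_add_distrib]
      rw [TensorProduct.tmul_sum, TensorProduct.sum_tmul]
      split_ifs <;> simp
    rw [h]
    exact Submodule.add_mem _ (Submodule.add_mem _ (hite _ (mem_tensor h0 h2))
      (hite _ (mem_tensor h2 h0))) (Submodule.sum_mem _ fun i _ => hite _ (mem_tensor h1 h1))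

/-- Arity and degree of an `n`-ary tree both depend only on its weight, so each tree sum is
homogeneous. -/
lemma homPart_treeSum (hn : 1 ≤ n) (m : ℕ) (d : ℤ) (w : Fin 3) :
    homPart degOne m d (treeSum k n w)
      = if m = 1 + (n - 1) * w ∧ d = (w : ℕ) then treeSum k n w else 0 := by
  classical
  ext T
  rw [homPart_apply, leaves_eq hn, degree_eq, treeSum_apply]
  by_cases hw : T.weight = w
  · rw [hw, if_pos rfl]
    by_cases h : m = 1 + (n - 1) * w ∧ d = (w : ℕ)
    · rw [if_pos h, if_pos ⟨h.1.symm, h.2.symm⟩, treeSum_apply, if_pos hw]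
    · rw [if_neg h, if_neg fun h' => h ⟨h'.1.symm, h'.2.symm⟩]
      rfl
  · rw [if_neg hw]
    split_ifs
    · rw [treeSum_apply, if_neg hw]
    · rfl
    · rw [treeSum_apply, if_neg hw]
    · rfl

lemma isSubcooperad_mockSpan (hn : 1 ≤ n) : IsSubcooperad degOne (mockSpan k n) := by
  constructor
  · intro x hx m d
    have h : mockSpan k n ≤ (mockSpan k n).comap (homPartₗ degOne m d) := by
      refine Submodule.span_le.2 ?_
      rintro _ ⟨w, rfl⟩
      change homPart degOne m d (treeSum k n w) ∈ mockSpan k n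
      rw [homPart_treeSum hn]
      split_ifs
      · exact treeSum_mem w
      · exact Submodule.zero_mem _
    exact h hx
  · intro p x hx
    have h : mockSpan k n ≤ (LinearMap.range (TensorProduct.map (mockSpan k n).subtype
        (mockSpan k n).subtype)).comap (decomp degOne p) := by
      refine Submodule.span_le.2 ?_
      rintro _ ⟨w, rfl⟩
      exact decomp_treeSum_mem p w
    exact h hx

lemma weightPart_mockSpan {x : TreeSpace k Unit fun _ => n} (hx : x ∈ mockSpan k n) :
    weightPart 2 x ∈ Submodule.span k {relator k n} := by
  obtain ⟨a, rfl⟩ := mem_mockSpan_iff.1 hx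
  refine Submodule.mem_span_singleton.2 ⟨a 2, ?_⟩
  ext T
  change (a 2 • treeSum k n 2) T = _
  rw [Finsupp.smul_apply, treeSum_apply]
  change (a 2 • if T.weight = 2 then 1 else 0) = _
  by_cases h : T.weight = 2
  · rw [weightPart, Finsupp.filter_apply_pos (fun T : NTree n => T.weight = 2) _ h,
      sum_treeSum_apply a 2 h, if_pos h, smul_eq_mul, mul_one]
  · rw [weightPart, Finsupp.filter_apply_neg (fun T : NTree n => T.weight = 2) _ h, if_neg h,
      smul_zero]

end Lower

/-! ### Identification of the two cooperads. -/

lemma mockTotallyCoassociative_eq [NeZero (2 : k)] (hn : 2 ≤ n) :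
    mockTotallyCoassociative k n hn = mockSpan k n := by
  refine le_antisymm (sSup_le fun Q hQ => le_mockSpan hn hQ.1 hQ.2) (le_sSup ⟨?_, ?_⟩)
  · exact isSubcooperad_mockSpan (by omega)
  · exact fun x hx => weightPart_mockSpan hx

lemma doubleSuspension_of_deg_zero :
    (doubleSuspension (k := k) fun _ : Unit => (0 : ℤ)) =
      (LinearMap.id : (TreeSpace k Unit fun _ => n) →ₗ[k] _) := by
  ext1 T
  ext1
  rw [LinearMap.comp_apply, LinearMap.comp_apply, doubleSuspension, Finsupp.lsingle_apply,
    Finsupp.linearCombination_single]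
  cases T <;> simp [rootDegree]

lemma koszulDual_mockPartiallyAssociative (hn : 2 ≤ n) :
    (mockPartiallyAssociative k n hn).koszulDual = mockTotallyCoassociative k n hn := by
  change sSup {Q : Submodule k (TreeSpace k Unit fun _ => n) | IsSubcooperad degOne Q ∧
    ∀ x ∈ Q, weightPart 2 x ∈ (Submodule.span k {relator k n}).map
      (doubleSuspension fun _ : Unit => (0 : ℤ))} = _
  rw [doubleSuspension_of_deg_zero, Submodule.map_id]
  rfl

/-! ### Dimensions, Euler characteristics and the Poincaré series. -/

section Euler

lemma homComponent_mockSpan (hn : 1 ≤ n) (m : ℕ) (d : ℤ) :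
    homComponent degOne (mockSpan k n) m d = Submodule.span k
      (treeSum k n '' {w | m = 1 + (n - 1) * w ∧ d = (w : ℕ)}) := by
  classical
  apply le_antisymm
  · rintro x ⟨hx, hs⟩
    obtain ⟨a, rfl⟩ := mem_mockSpan_iff.1 hx
    have h1 : homPartₗ degOne m d (∑ w, a w • treeSum k n w) = ∑ w, a w • treeSum k n w := by
      ext T
      change homPart _ m d _ T = _
      rw [homPart_apply]
      split_ifs with h
      · rfl
      · exact ((Finsupp.mem_supported' k _).1 hs T h).symm
    rw [← h1, map_sum]
    refine Submodule.sum_mem _ fun w _ => ?_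
    rw [map_smul]
    refine Submodule.smul_mem _ _ ?_
    change homPart degOne m d _ ∈ _
    rw [homPart_treeSum hn]
    split_ifs with h
    · exact Submodule.subset_span ⟨w, h, rfl⟩
    · exact Submodule.zero_mem _
  · refine Submodule.span_le.2 ?_
    rintro _ ⟨w, ⟨rfl, rfl⟩, rfl⟩
    refine ⟨treeSum_mem w, (Finsupp.mem_supported' k _).2 fun T hT => ?_⟩
    rw [treeSum_apply, if_neg]
    intro h
    apply hT
    simp [leaves_eq hn, degree_eq, h]

lemma treeSum_ne_zero (hn : 1 ≤ n) (w : Fin 3) : treeSum k n w ≠ 0 := by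
  obtain ⟨T, hT⟩ : ∃ T : NTree n, T.weight = w := by
    fin_cases w
    · exact ⟨.leaf, rfl⟩
    · exact ⟨cor n, weight_cor⟩
    · exact ⟨cc ⟨0, hn⟩, weight_cc _⟩
  intro h
  have := DFunLike.congr_fun h T
  rw [treeSum_apply, if_pos hT] at this
  exact one_ne_zero this

lemma finrank_homComponent_mockSpan (hn : 2 ≤ n) (m : ℕ) (d : ℤ) :
    (Module.finrank k (homComponent degOne (mockSpan k n) m d) : ℤ)
      = ∑ w : Fin 3, if m = 1 + (n - 1) * w ∧ d = (w : ℕ) then 1 else 0 := by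
  rw [homComponent_mockSpan (by omega)]
  by_cases h : ∃ w : Fin 3, m = 1 + (n - 1) * w ∧ d = (w : ℕ)
  · obtain ⟨w, hw⟩ := h
    -- The degree alone recovers the weight, so a homogeneous component contains at most one of the
    -- three generators.
    have huniq : ∀ v : Fin 3, (m = 1 + (n - 1) * v ∧ d = (v : ℕ)) ↔ v = w := by
      intro v
      constructor
      · rintro ⟨-, hv⟩
        have := hw.2
        ext
        omega
      · rintro rfl
        exact hw
    have hset : {w : Fin 3 | m = 1 + (n - 1) * w ∧ d = (w : ℕ)} = {w} := Set.ext huniq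
    have h1 := finrank_span_singleton (K := k) (treeSum_ne_zero (k := k) (one_le_two.trans hn) w)
    simp only [huniq, Finset.sum_ite_eq', Finset.mem_univ, if_true]
    rw [hset, Set.image_singleton]
    exact congrArg Nat.cast h1
  · push Not at h
    have hempty : {w : Fin 3 | m = 1 + (n - 1) * w ∧ d = (w : ℕ)} = ∅ := by
      ext v
      simpa using h v
    rw [hempty, Set.image_empty, Submodule.span_empty, finrank_bot, Finset.sum_eq_zero]
    · rfl
    · intro v _
      rw [if_neg]
      exact fun h' => h v h'.1 h'.2

lemma eulerChar_mockSpan (hn : 2 ≤ n) (m : ℕ) :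
    eulerChar degOne (mockSpan k n) m
      = ∑ w : Fin 3, if m = 1 + (n - 1) * w then (-1) ^ (w : ℕ) else 0 := by
  rw [eulerChar]
  simp only [finrank_homComponent_mockSpan hn, Finset.mul_sum]
  rw [finsum_sum_comm]
  · refine Finset.sum_congr rfl fun w _ => ?_
    rw [finsum_eq_single _ ((w : ℕ) : ℤ)]
    · by_cases h : m = 1 + (n - 1) * w
      · rw [if_pos ⟨h, rfl⟩, if_pos h, mul_one, Int.coe_negOnePow_natCast]
      · rw [if_neg fun h' => h h'.1, if_neg h, mul_zero]
    · intro d hd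
      rw [if_neg fun h' => hd h'.2, mul_zero]
  · intro w _
    refine (Set.finite_singleton ((w : ℕ) : ℤ)).subset fun d hd => ?_
    by_contra hne
    exact hd (by simp only; rw [if_neg fun h' => hne h'.2, mul_zero])

lemma poincareSeries_mockSpan (hn : 2 ≤ n) :
    poincareSeries degOne (mockSpan k n)
      = (PowerSeries.X - PowerSeries.X ^ n + PowerSeries.X ^ (2 * n - 1) : ℤ⟦X⟧) := by
  ext m
  have h1 : 1 + (n - 1) = n := by omega
  have h2 : 1 + (n - 1) * 2 = 2 * n - 1 := by omega
  rw [poincareSeries, PowerSeries.coeff_mk, eulerChar_mockSpan hn, Fin.sum_univ_three]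
  simp only [map_add, map_sub, PowerSeries.coeff_X, PowerSeries.coeff_X_pow, Fin.val_zero,
    Fin.val_one, Fin.val_two, mul_zero, mul_one, add_zero, h1, h2]
  split_ifs <;> simp

end Euler

end Mock

end NSOperad

end

theorem mainTheorem3 (k : Type*) [Field k] [CharZero k] :
    -- the Koszul dual cooperad is the mock totally coassociative cooperad,
    (NSOperad.mockPartiallyAssociative k 8 (by norm_num)).koszulDual
      = NSOperad.mockTotallyCoassociative k 8 (by norm_num) ∧
    -- its components are finite-dimensional, and its Poincaré series is `t - t ^ 8 + t ^ 15`;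
    (∀ m, FiniteDimensional k
      (NSOperad.component (NSOperad.mockTotallyCoassociative k 8 (by norm_num)) m)) ∧
    NSOperad.poincareSeries (fun _ => 1) (NSOperad.mockTotallyCoassociative k 8 (by norm_num))
      = (PowerSeries.X - PowerSeries.X ^ 8 + PowerSeries.X ^ 15 : ℤ⟦X⟧) ∧
    -- the compositional inverse of that series is `t h(t ^ 7)`, with `h` positive;
    (∃ h : ℤ⟦X⟧, (∀ n, 0 < PowerSeries.coeff n h) ∧
      ∀ f : ℤ⟦X⟧,
        NSOperad.IsCompInverse
          (PowerSeries.X - PowerSeries.X ^ 8 + PowerSeries.X ^ 15 : ℤ⟦X⟧) f ↔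
        f = PowerSeries.X * PowerSeries.subst (PowerSeries.X ^ 7 : ℤ⟦X⟧) h) ∧
    -- so the positivity criterion does not detect non-Koszulness.
    ¬ NSOperad.DetectedByPositivityCriterion
      (NSOperad.mockPartiallyAssociative k 8 (by norm_num)) := by
  have hK := NSOperad.koszulDual_mockPartiallyAssociative (k := k) (n := 8) (by norm_num)
  have hM := NSOperad.mockTotallyCoassociative_eq (k := k) (n := 8) (by norm_num)
  have hP : NSOperad.poincareSeries (fun _ => 1)
      (NSOperad.mockTotallyCoassociative k 8 (by norm_num))
      = (PowerSeries.X - PowerSeries.X ^ 8 + PowerSeries.X ^ 15 : ℤ⟦X⟧) := by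
    rw [hM]
    exact NSOperad.poincareSeries_mockSpan (by norm_num)
  refine ⟨hK, fun m => ?_, hP, NSOperad.exists_isCompInverse, ?_⟩
  · have : FiniteDimensional k (NSOperad.mockSpan k 8) :=
      FiniteDimensional.span_of_finite k (Set.finite_range _)
    rw [hM]
    exact Submodule.finiteDimensional_of_le (inf_le_left : _ ≤ NSOperad.mockSpan k 8)
  · rintro ⟨f, hf, i, hi⟩
    obtain ⟨h, hpos, hh⟩ := NSOperad.exists_isCompInverse
    rw [hK] at hf
    change NSOperad.IsCompInverse (NSOperad.poincareSeries (fun _ => 1)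
      (NSOperad.mockTotallyCoassociative k 8 (by norm_num))) f at hf
    rw [hP] at hf
    -- By uniqueness, the inverse supplied by the criterion is the one with nonnegative
    -- coefficients.
    rw [(hh f).1 hf] at hi
    exact absurd hi (NSOperad.coeff_X_mul_subst_nonneg hpos i).not_gt
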